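/- **Setting.** Let $d\ge 1$, let $\Omega\subset\mathbb R^d$ be a bounded polyhedral Lipschitz domain, and let $V:=H^1_0(\Omega)$. Let $A\in L^\infty(\Omega,\mathbb R^{d\times d}_{\mathrm{sym}})$ have spectrum $\sigma(A(x))\subset[\alpha,\beta]$ for almost all $x\in\Omega$, where $0<\alpha\le\beta<\infty$. Write $(u,v):=\int_\Omega uv\,dx$, $\|u\|:=(u,u)^{1/2}$, $a(u,v):=\int_\Omega (A\nabla u)\cdot\nabla v\,dx$ and $|||u|||:=a(u,u)^{1/2}$. Let $\mathcal T_H$ be a regular (conforming) finite mesh of $\Omega$ into closed simplices, with maximal mesh size $H:=\max_{T\in\mathcal T_H}\operatorname{diam}T$ and shape regularity parameter $\max_{T\in\mathcal T_H}\operatorname{diam}T/\operatorname{diam}B_T\le\gamma$, where $B_T$ is the largest ball contained in $T$. Let $V_H$ be the space of those $v\in V$ that are affine on every $T\in\mathcal T_H$. Let $\mathcal N_H$ be the set of interior vertices of $\mathcal T_H$, let $N_H:=|\mathcal N_H|=\dim V_H$, and let $\phi_z$ ($z\in\mathcal N_H$) be the nodal basis functions of $V_H$. Define $\mathcal I_Hv:=\sum_{z\in\mathcal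 N_H}\frac{(v,\phi_z)}{(1,\phi_z)}\phi_z$ for $v\in V$. Let $V_h$ be a closed subspace of $V$ with $V_H\subseteq V_h$ (for instance a finite element space on a refinement of $\mathcal T_H$, or $V_h=V$). Let $V_f:=\{v\in V_h:\mathcal I_Hv=0\}$, let $P_f:V_h\to V_f$ be the $a$-orthogonal projection, and let $V_c:=(1-P_f)V_H$, which has dimension $N_H$. Let $\lambda_h^{(1)}\le\lambda_h^{(2)}\le\dots$ be the eigenvalues, repeated according to multiplicity, and $u_h^{(k)}\in V_h$ corresponding $L^2(\Omega)$-orthonormal eigenfunctions of the problem $a(u_h^{(k)},v)=\lambda_h^{(k)}(u_h^{(k)},v)$ for all $v\in V_h$ ($1\le k\le\dim V_h$). Let $\lambda_H^{(1)}\le\dots\le\lambda_H^{(N_H)}$ and $u_c^{(k)}\in V_c$ be the eigenvalues, repeated according to multiplicity, and $L^2(\Omega)$-orthonormal eigenfunctions of the problem $a(u_c^{(k)},v)=\lambda_H^{(k)}(u_c^{(k)},v)$ for all $v\in V_c$. **Theorem.** There are constants $c,C>0$ that depend only on $\Omega$ and $\gamma$ (in particular not on $\mathcal T_H$, $H$,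 $V_h$, $A$, $\alpha$, $\beta$, $\ell$, $r$) such that the following holds. Let $\ell,r\ge1$ with $\ell+r-1\le N_H$, and let $\lambda_h^{(\ell)}$ be an eigenvalue of multiplicity $r$ with $\lambda_h^{(\ell)}=\dots=\lambda_h^{(\ell+r-1)}$. Put $$\rho:=\max_{1\le j\le N_H,\ j\notin\{\ell,\dots,\ell+r-1\}}\frac{\lambda_h^{(\ell)}}{|\lambda_h^{(\ell)}-\lambda_H^{(j)}|}$$ ($\rho:=0$ if there is no such $j$, and $\rho:=\infty$ if a denominator vanishes). If $\rho<\infty$ and $$H\le c\,\ell^{-1/3}(1+\rho)^{-1/3}\sqrt{\alpha/\lambda_h^{(\ell)}},$$ then $\operatorname{span}\{u_h^{(\ell)},\dots,u_h^{(\ell+r-1)}\}$ has an $L^2(\Omega)$-orthonormal basis $\tilde u_h^{(\ell)},\dots,\tilde u_h^{(\ell+r-1)}$ such that for all $j=0,\dots,r-1$ $$|||\tilde u_h^{(\ell+j)}-u_c^{(\ell+j)}|||\le C\Big(\sqrt{\ell}\,\frac{(\lambda_h^{(\ell)})^{3/2}}{\alpha}H^2+\ell(1+\rho)\frac{(\lambda_h^{(\ell)})^2}{\alpha^{3/2}}H^3\Big),$$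 $$\|\tilde u_h^{(\ell+j)}-u_c^{(\ell+j)}\|\le C\,\ell(1+\rho)\Big(\frac{\lambda_h^{(\ell)}}{\alpha}\Big)^{3/2}H^3 .$$ -/

import Mathlib

open MeasureTheory Set
open scoped ENNReal ContDiff Matrix

noncomputable section

namespace Upscaling

/-- Euclidean space `ℝᵈ`. -/
abbrev E (d : ℕ) : Type := EuclideanSpace ℝ (Fin d)

/-! ### Domains -/

/-- A bounded Lipschitz domain: a bounded, connected, nonempty open set which, near every boundary
point, is the strict epigraph, in some direction `n`, of a Lipschitz function `g` of the variables
orthogonal to `n` (that is, `g` is constant along `n`). -/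
structure IsBoundedLipschitzDomain {d : ℕ} (Ω : Set (E d)) : Prop where
  isOpen : IsOpen Ω
  isConnected : IsConnected Ω
  isBounded : Bornology.IsBounded Ω
  lipschitz : ∀ x₀ ∈ frontier Ω, ∃ (n : E d) (g : E d → ℝ) (K : NNReal),
    ‖n‖ = 1 ∧ LipschitzWith K g ∧ (∀ (x : E d) (t : ℝ), g (x + t • n) = g x) ∧
      ∃ U ∈ nhds x₀, ∀ x ∈ U, (x ∈ Ω ↔ g x < inner ℝ n x)

/-! ### The space `H¹₀(Ω)` -/

/-- Pairs (function, vector field) in `L²(Ω) × L²(Ω; ℝᵈ)` with the Hilbert norm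
`(‖f‖² + ‖F‖²)^{1/2}`; on pairs `(u, ∇u)` this is the `H¹` norm. -/
abbrev L2Pair {d : ℕ} (Ω : Set (E d)) : Type :=
  WithLp 2 (Lp ℝ 2 (volume.restrict Ω) × Lp (E d) 2 (volume.restrict Ω))

/-- The pairs `(φ, ∇φ)` with `φ ∈ C_c^∞(Ω)`. -/
def testPairs {d : ℕ} (Ω : Set (E d)) : Set (L2Pair Ω) :=
  {p | ∃ φ : E d → ℝ, ContDiff ℝ ∞ φ ∧ HasCompactSupport φ ∧ tsupport φ ⊆ Ω ∧
    (p.fst : E d → ℝ) =ᵐ[volume.restrict Ω] φ ∧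
    (p.snd : E d → E d) =ᵐ[volume.restrict Ω] gradient φ}

/-- `H¹₀(Ω)`: the closure of `C_c^∞(Ω)` in the `H¹` norm, an element being represented by the
function together with its weak gradient (which the function determines). The set `testPairs Ω` is
already a linear subspace, so that taking its span adds nothing. -/
def H10 {d : ℕ} (Ω : Set (E d)) : Submodule ℝ (L2Pair Ω) :=
  (Submodule.span ℝ (testPairs Ω)).topologicalClosure

/-- The Hilbert space `V = H¹₀(Ω)` as a type. -/
abbrev V {d : ℕ} (Ω : Set (E d)) : Type := ↥(H10 Ω)

variable {d : ℕ} {Ω : Set (E d)}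

/-- The function underlying an element of `H¹₀(Ω)` (meaningful a.e. on `Ω`). -/
def V.fn (u : V Ω) : E d → ℝ := (u : L2Pair Ω).fst

/-- The weak gradient of an element of `H¹₀(Ω)` (meaningful a.e. on `Ω`). -/
def V.grad (u : V Ω) : E d → E d := (u : L2Pair Ω).snd

/-- The `L²(Ω)` scalar product. -/
def l2 (u v : V Ω) : ℝ := ∫ x in Ω, u.fn x * v.fn x

/-- The `L²(Ω)` norm. -/
def l2norm (u : V Ω) : ℝ := √(l2 u u)

/-- A coefficient `A ∈ L^∞(Ω; ℝ^{d×d}_sym)` with spectrum in `[α, β]` almost everywhere,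
`0 < α ≤ β < ∞`. -/
structure IsCoefficient (Ω : Set (E d)) (A : E d → Matrix (Fin d) (Fin d) ℝ) (α β : ℝ) :
    Prop where
  pos : 0 < α
  le : α ≤ β
  measurable : ∀ i j, AEMeasurable (fun x => A x i j) (volume.restrict Ω)
  symm : ∀ᵐ x ∂(volume.restrict Ω), (A x).IsSymm
  spectrum_subset : ∀ᵐ x ∂(volume.restrict Ω), spectrum ℝ (A x) ⊆ Icc α β

/-- The bilinear form `a(u, v) = ∫_Ω (A ∇u) · ∇v dx`. -/
def aform (A : E d → Matrix (Fin d) (Fin d) ℝ) (u v : V Ω) : ℝ :=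
  ∫ x in Ω, (A x *ᵥ (u.grad x).ofLp) ⬝ᵥ (v.grad x).ofLp

/-- The energy norm `a(u, u)^{1/2}`. -/
def energyNorm (A : E d → Matrix (Fin d) (Fin d) ℝ) (u : V Ω) : ℝ := √(aform A u u)

/-! ### Meshes and finite element spaces -/

/-- The closed simplex with vertex set `T`. -/
def simplex (T : Finset (E d)) : Set (E d) := convexHull ℝ (T : Set (E d))

/-- The diameter of the largest ball contained in the simplex with vertex set `T`. -/
def inballDiam (T : Finset (E d)) : ℝ :=
  sSup {δ : ℝ | ∃ (x : E d) (ρ : ℝ), 0 ≤ ρ ∧ Metric.closedBall x ρ ⊆ simplex T ∧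
    δ = Metric.diam (Metric.closedBall x ρ)}

/-- A regular (conforming) simplicial mesh of `Ω`: finitely many nondegenerate closed
`d`-simplices, given by their vertex sets, which cover the closure of `Ω` and any two of which
meet in the (possibly empty) face spanned by their common vertices. In particular a domain that
has a mesh is polyhedral. -/
structure Mesh (Ω : Set (E d)) where
  cells : Finset (Finset (E d))
  card_eq : ∀ T ∈ cells, T.card = d + 1
  indep : ∀ T ∈ cells, AffineIndependent ℝ (fun y : T => (y : E d))
  conforming : ∀ S ∈ cells, ∀ T ∈ cells,
    simplex S ∩ simplex T = convexHull ℝ ((S : Set (E d)) ∩ (T : Set (E d)))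
  cover : ⋃ T ∈ cells, simplex T = closure Ω

namespace Mesh

/-- The maximal mesh size `H = max_T diam T`. -/
def size (𝒯 : Mesh Ω) : ℝ := ⨆ T : 𝒯.cells, Metric.diam (simplex (T : Finset (E d)))

/-- The shape regularity parameter `max_T diam T / diam B_T`, where `B_T` is the largest ball
contained in `T`. -/
def shapeRegularity (𝒯 : Mesh Ω) : ℝ :=
  ⨆ T : 𝒯.cells, Metric.diam (simplex (T : Finset (E d))) / inballDiam (T : Finset (E d))

open Classical in
/-- The interior vertices of the mesh. -/
def interiorVertices (𝒯 : Mesh Ω) : Finset (E d) := (𝒯.cells.biUnion id).filter (· ∈ Ω)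

/-- The number `N_H` of interior vertices (which is the dimension of `V_H`). -/
def numInterior (𝒯 : Mesh Ω) : ℕ := 𝒯.interiorVertices.card

/-- The vertices of a cell as an affine basis of `ℝᵈ`; its coordinates are the barycentric
coordinates of the cell. -/
def cellBasis (𝒯 : Mesh Ω) (T : Finset (E d)) (hT : T ∈ 𝒯.cells) : AffineBasis T ℝ (E d) where
  toFun := fun y => (y : E d)
  ind' := 𝒯.indep T hT
  tot' := by
    rw [(𝒯.indep T hT).affineSpan_eq_top_iff_card_eq_finrank_add_one]
    simp [𝒯.card_eq T hT]

open Classical in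
/-- The nodal (hat) function `φ_z`: on a cell `T` with vertex `z` it is the barycentric coordinate
of `T` belonging to `z`, and it vanishes off the cells that contain `z`. By conformity its value
at a point shared by several cells does not depend on the cell that is chosen. -/
def hat (𝒯 : Mesh Ω) (z x : E d) : ℝ :=
  if h : ∃ T, ∃ _ : T ∈ 𝒯.cells, ∃ _ : z ∈ T, x ∈ simplex T then
    (𝒯.cellBasis h.choose h.choose_spec.choose).coord
      ⟨z, h.choose_spec.choose_spec.choose⟩ x
  else 0

/-- The first-order conforming finite element space
`V_H = {v ∈ H¹₀(Ω) : v|_T is affine for every cell T}`. -/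
def VH (𝒯 : Mesh Ω) : Submodule ℝ (V Ω) where
  carrier := {v | ∀ T ∈ 𝒯.cells, ∃ f : E d →ᵃ[ℝ] ℝ,
    ∀ᵐ x ∂(volume.restrict Ω), x ∈ simplex T → v.fn x = f x}
  zero_mem' := by
    intro T _
    refine ⟨0, ?_⟩
    filter_upwards [Lp.coeFn_zero ℝ 2 (volume.restrict Ω)] with x hx _
    simpa [V.fn] using hx
  add_mem' := by
    intro u v hu hv T hT
    obtain ⟨f, hf⟩ := hu T hT
    obtain ⟨g, hg⟩ := hv T hT
    refine ⟨f + g, ?_⟩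
    filter_upwards [hf, hg, Lp.coeFn_add (u : L2Pair Ω).fst (v : L2Pair Ω).fst]
      with x h1 h2 h3 hx
    have e1 := h1 hx
    have e2 := h2 hx
    simp only [V.fn] at e1 e2 ⊢
    simpa [e1, e2] using h3
  smul_mem' := by
    intro c u hu T hT
    obtain ⟨f, hf⟩ := hu T hT
    refine ⟨c • f, ?_⟩
    filter_upwards [hf, Lp.coeFn_smul c (u : L2Pair Ω).fst] with x h1 h3 hx
    have e1 := h1 hx
    simp only [V.fn] at e1 ⊢
    simpa [e1] using h3

/-- The weighted Clément quasi-interpolation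
`I_H v = ∑_z ((v, φ_z) / (1, φ_z)) φ_z`, the sum running over the interior vertices. -/
def clement (𝒯 : Mesh Ω) (v : V Ω) (x : E d) : ℝ :=
  ∑ z ∈ 𝒯.interiorVertices,
    ((∫ y in Ω, v.fn y * 𝒯.hat z y) / ∫ y in Ω, 𝒯.hat z y) * 𝒯.hat z x

/-- The fine scale space `V_f = ker (I_H |_{V_h})`. -/
def fineSpace (𝒯 : Mesh Ω) (Vh : Submodule ℝ (V Ω)) : Set (V Ω) :=
  {v | v ∈ Vh ∧ ∀ x ∈ Ω, 𝒯.clement v x = 0}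

/-- `p = P_f v`: `p` is the `a`-orthogonal projection of `v` onto the fine scale space, i.e.
`p ∈ V_f` and `a(p, q) = a(v, q)` for all `q ∈ V_f`. -/
def IsFineProjection (𝒯 : Mesh Ω) (A : E d → Matrix (Fin d) (Fin d) ℝ)
    (Vh : Submodule ℝ (V Ω)) (v p : V Ω) : Prop :=
  p ∈ 𝒯.fineSpace Vh ∧ ∀ q ∈ 𝒯.fineSpace Vh, aform A p q = aform A v q

/-- The generalized coarse space `V_c = (1 - P_f) V_H = {w - P_f w : w ∈ V_H}`. For a coefficient
`A` this set is a linear subspace already, so that taking its span adds nothing. -/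
def coarseSpace (𝒯 : Mesh Ω) (A : E d → Matrix (Fin d) (Fin d) ℝ)
    (Vh : Submodule ℝ (V Ω)) : Submodule ℝ (V Ω) :=
  Submodule.span ℝ {v | ∃ w ∈ 𝒯.VH, ∃ p, 𝒯.IsFineProjection A Vh w p ∧ v = w - p}

end Mesh

/-! ### Eigenpairs -/

/-- `(μ, w)` solves the Rayleigh-Ritz eigenproblem in the subspace `W`:
`w ∈ W` and `a(w, v) = μ (w, v)` for all `v ∈ W`. (`w = 0` is not excluded here.) -/
def SolvesEigenproblem (A : E d → Matrix (Fin d) (Fin d) ℝ) (W : Submodule ℝ (V Ω))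
    (μ : ℝ) (w : V Ω) : Prop :=
  w ∈ W ∧ ∀ v ∈ W, aform A w v = μ * l2 w v

/-- The indices of the eigenpairs in `W`: `1 ≤ k ≤ dim W` (all `k ≥ 1` if `dim W = ∞`). -/
def IsIndex (W : Submodule ℝ (V Ω)) (k : ℕ) : Prop :=
  1 ≤ k ∧ (k : Cardinal) ≤ Module.rank ℝ W

/-- `(lam k, u k)`, `1 ≤ k ≤ dim W`, is the list of the eigenpairs of the eigenproblem in `W`:
the eigenvalues in ascending order and repeated according to their multiplicity, the
eigenfunctions orthonormal in `L²(Ω)`. Values at other indices `k` are irrelevant. -/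
structure IsEigenSystem (A : E d → Matrix (Fin d) (Fin d) ℝ) (W : Submodule ℝ (V Ω))
    (lam : ℕ → ℝ) (u : ℕ → V Ω) : Prop where
  solves : ∀ k, IsIndex W k → SolvesEigenproblem A W (lam k) (u k)
  norm_eq : ∀ k, IsIndex W k → l2norm (u k) = 1
  orthogonal : ∀ k m, IsIndex W k → IsIndex W m → k ≠ m → l2 (u k) (u m) = 0
  ascending : ∀ k m, IsIndex W k → IsIndex W m → k ≤ m → lam k ≤ lam m
  complete : ∀ (μ : ℝ) (w : V Ω), SolvesEigenproblem A W μ w →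
    w ∈ Submodule.span ℝ (u '' {k | IsIndex W k ∧ lam k = μ})

/-- The quantity `ρ = max_j μ / |μ - λ_H^{(j)}|`, the maximum over those `1 ≤ j ≤ N` that are not
among `ℓ, …, ℓ + r - 1`; it is `∞` if `λ_H^{(j)} = μ` for such a `j`, and `0` if there is no
such `j`. -/
def gapRatio (N ℓ r : ℕ) (μ : ℝ) (lamH : ℕ → ℝ) : ℝ≥0∞ :=
  ⨆ j ∈ {j : ℕ | 1 ≤ j ∧ j ≤ N ∧ ¬ (ℓ ≤ j ∧ j ≤ ℓ + r - 1)},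
    ENNReal.ofReal μ / ENNReal.ofReal |μ - lamH j|

end Upscaling

end

/-! The coarse space is the energy-orthogonal complement of the fine scale space in `Vh`
(`Mesh.coarseSpace_structure`). An eigenfunction `u` for the eigenvalue `λ` therefore splits as `u =
w + f` with `w` coarse and `f` fine, and `w` is its energy projection. Evaluating the
quasi-interpolant at interior vertices shows that `f` is fine exactly when it lies in `Vh` and is
`L²`-orthogonal to every nodal function.

The analytic core is `Mesh.exists_abs_inner_le`: such an `f` satisfies `|(f, v)| ≤ C₁ H ‖f‖ ‖∇v‖`,
because `v` may be replaced by its error against a nodal combination. The combination used has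
averages of `v` over balls of radius `κ H` as nodal values. At vertices on the boundary the value
zero is itself such an average, by the exterior ball condition for Lipschitz domains.

Put `η = C₁ H / √α`. Testing with `f` gives `‖f‖ ≤ η |||f|||`. The identity `|||f|||² = λ (f, u)`
uses the smallness twice, once through `u` and once through `‖f‖`, and yields `|||f||| ≤ λ^{3/2} η²
‖u‖` and `‖f‖ ≤ λ^{3/2} η³ ‖u‖` (`fine_part_bounds`). This is the source of the powers `H²` and
`H³`.

The rest is linear algebra (`exists_orthonormal_near`). The coefficients `c_i` of `w` in the
discrete eigenfunctions satisfy `(λ_i - λ) c_i = λ (u_c^i, f)`. The spectral gap and Bessel's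
inequality bound the part of `w` outside the cluster by `ρ ‖f‖`. Hence the eigenspace is within `(1
+ ρ) ‖f‖` of the discrete cluster, the map to cluster coefficients almost preserves norms, and its
polar factor (`exists_linearIsometryEquiv_near`) selects the orthonormal basis. The energy error
follows by Pythagoras, since `f` is energy-orthogonal to the coarse space. -/

namespace Upscaling

/-! ### Averages over balls -/

section Averages

lemma enorm_integral_sq_le {X : Type*} [MeasurableSpace X] (μ : Measure X)
    [IsProbabilityMeasure μ] {f : X → ℝ} (hf : AEStronglyMeasurable f μ) :
    ‖∫ x, f x ∂μ‖ₑ ^ 2 ≤ ∫⁻ x, ‖f x‖ₑ ^ 2 ∂μ := by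
  have h1 : ‖∫ x, f x ∂μ‖ₑ ≤ eLpNorm f 2 μ := by
    calc ‖∫ x, f x ∂μ‖ₑ ≤ ∫⁻ x, ‖f x‖ₑ ∂μ := MeasureTheory.enorm_integral_le_lintegral_enorm f
      _ = eLpNorm f 1 μ := by rw [eLpNorm_one_eq_lintegral_enorm]
      _ ≤ eLpNorm f 2 μ := eLpNorm_le_eLpNorm_of_exponent_le (by norm_num) hf
  calc ‖∫ x, f x ∂μ‖ₑ ^ 2 ≤ eLpNorm f 2 μ ^ 2 := by gcongr
    _ = ∫⁻ x, ‖f x‖ₑ ^ 2 ∂μ := by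
      rw [eLpNorm_eq_lintegral_rpow_enorm_toReal (by norm_num) (by norm_num)]
      rw [← ENNReal.rpow_natCast, ← ENNReal.rpow_mul]
      simp

lemma isProbabilityMeasure_unitInterval :
    IsProbabilityMeasure (volume.restrict (Icc (0 : ℝ) 1)) := ⟨by simp⟩

variable {d : ℕ} {v : E d → ℝ}

/-- The fundamental theorem of calculus along the segment, followed by Jensen's inequality on `[0,
1]`. -/
lemma enorm_add_sub_sq_le (hv : ContDiff ℝ 1 v) (x ξ : E d) :
    ‖v (x + ξ) - v x‖ₑ ^ 2 ≤
      ‖ξ‖ₑ ^ 2 * ∫⁻ s in Icc (0 : ℝ) 1, ‖fderiv ℝ v (x + s • ξ)‖ₑ ^ 2 := by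
  have := isProbabilityMeasure_unitInterval
  have hc : Continuous (fun s : ℝ => fderiv ℝ v (x + s • ξ) ξ) :=
    ((hv.continuous_fderiv one_ne_zero).comp (by fun_prop)).clm_apply continuous_const
  have hd : ∀ s : ℝ, HasDerivAt (fun s : ℝ => v (x + s • ξ)) (fderiv ℝ v (x + s • ξ) ξ) s := by
    intro s
    have h1 : HasDerivAt (fun s : ℝ => x + s • ξ) ξ s := by
      simpa using ((hasDerivAt_id s).smul_const ξ).const_add x
    exact ((hv.differentiable one_ne_zero _).hasFDerivAt).comp_hasDerivAt s h1
  have key : v (x + ξ) - v x = ∫ s in Icc (0 : ℝ) 1, fderiv ℝ v (x + s • ξ) ξ := by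
    rw [integral_Icc_eq_integral_Ioc, ← intervalIntegral.integral_of_le zero_le_one,
      intervalIntegral.integral_eq_sub_of_hasDerivAt (fun s _ => hd s) (hc.intervalIntegrable _ _)]
    simp
  rw [key]
  refine (enorm_integral_sq_le _ hc.aestronglyMeasurable).trans ?_
  rw [← lintegral_const_mul' _ _ (by simp)]
  refine lintegral_mono fun s => ?_
  rw [← mul_pow, mul_comm]
  gcongr
  exact (fderiv ℝ v (x + s • ξ)).le_opENorm ξ

lemma measurable_enorm_fderiv_sq (hv : ContDiff ℝ 1 v) :
    Measurable (fun x => ‖fderiv ℝ v x‖ₑ ^ 2) :=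
  ((hv.continuous_fderiv one_ne_zero).enorm.measurable).pow_const 2

/-- Translations of a `C¹` function in `L²`. -/
lemma lintegral_translate_sub_le (hv : ContDiff ℝ 1 v) (ξ : E d) :
    ∫⁻ x, ‖v (x + ξ) - v x‖ₑ ^ 2 ≤ ‖ξ‖ₑ ^ 2 * ∫⁻ x, ‖fderiv ℝ v x‖ₑ ^ 2 := by
  calc ∫⁻ x, ‖v (x + ξ) - v x‖ₑ ^ 2
      ≤ ∫⁻ x, ‖ξ‖ₑ ^ 2 * ∫⁻ s in Icc (0 : ℝ) 1, ‖fderiv ℝ v (x + s • ξ)‖ₑ ^ 2 :=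
        lintegral_mono fun x => enorm_add_sub_sq_le hv x ξ
    _ = ‖ξ‖ₑ ^ 2 * ∫⁻ x, ∫⁻ s in Icc (0 : ℝ) 1, ‖fderiv ℝ v (x + s • ξ)‖ₑ ^ 2 :=
        lintegral_const_mul' _ _ (by simp)
    _ = ‖ξ‖ₑ ^ 2 * ∫⁻ s in Icc (0 : ℝ) 1, ∫⁻ x, ‖fderiv ℝ v (x + s • ξ)‖ₑ ^ 2 := by
        rw [lintegral_lintegral_swap]
        exact ((measurable_enorm_fderiv_sq hv).comp
          (by fun_prop : Measurable fun p : E d × ℝ => p.1 + p.2 • ξ)).aemeasurable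
    _ = ‖ξ‖ₑ ^ 2 * ∫⁻ x, ‖fderiv ℝ v x‖ₑ ^ 2 := by
        congr 1
        simp_rw [lintegral_add_right_eq_self (fun x => ‖fderiv ℝ v x‖ₑ ^ 2)]
        simp

/-- Friedrichs' inequality. -/
lemma lintegral_sq_le_of_dist_le (hd : 1 ≤ d) (hv : ContDiff ℝ 1 v) {Ω : Set (E d)} {D : ℝ}
    (hD : 0 ≤ D) (hΩ : ∀ x ∈ Ω, ∀ y ∈ Ω, dist x y < D) (hsupp : ∀ x, x ∉ Ω → v x = 0) :
    ∫⁻ x, ‖v x‖ₑ ^ 2 ≤ ENNReal.ofReal D ^ 2 * ∫⁻ x, ‖fderiv ℝ v x‖ₑ ^ 2 := by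
  have : Nonempty (Fin d) := ⟨⟨0, hd⟩⟩
  -- A translation by a distance `D` pushes every point of `Ω` out of `Ω`, so one of `v (x + ξ)`, `v
  -- x` always vanishes.
  obtain ⟨ξ, hξ⟩ : ∃ ξ : E d, ‖ξ‖ = D := exists_norm_eq (E d) hD
  refine le_trans ?_ ((lintegral_translate_sub_le hv ξ).trans_eq ?_)
  · refine lintegral_mono fun x => ?_
    by_cases hx : x ∈ Ω
    · have : x + ξ ∉ Ω := fun h => by
        have := hΩ x hx _ h
        simp [hξ] at this
      simp [hsupp _ this]
    · simp [hsupp _ hx]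
  · rw [← ofReal_norm, hξ]

/-- The uniform probability measure on the ball `B(0, k)`. -/
noncomputable def ballMeasure (d : ℕ) (k : ℝ) : Measure (E d) :=
  (volume (Metric.ball (0 : E d) k))⁻¹ • volume.restrict (Metric.ball (0 : E d) k)

lemma isProbabilityMeasure_ballMeasure {k : ℝ} (hk : 0 < k) :
    IsProbabilityMeasure (ballMeasure d k) := by
  refine ⟨?_⟩
  simp only [ballMeasure, Measure.smul_apply, Measure.restrict_apply_univ, smul_eq_mul]
  exact ENNReal.inv_mul_cancel (Metric.measure_ball_pos _ _ hk).ne' measure_ball_lt_top.ne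

/-- The average of `v` over the ball `B(y, k)`. -/
noncomputable def ballAverage (v : E d → ℝ) (k : ℝ) (y : E d) : ℝ :=
  ∫ ξ, v (y + ξ) ∂(ballMeasure d k)

lemma ae_ballMeasure {k : ℝ} {p : E d → Prop} (h : ∀ ξ, ‖ξ‖ < k → p ξ) :
    ∀ᵐ ξ ∂(ballMeasure d k), p ξ := by
  refine Measure.ae_smul_measure ?_ _
  exact (ae_restrict_mem Metric.isOpen_ball.measurableSet).mono fun ξ hξ => h ξ (by simpa using hξ)

lemma ballAverage_eq_zero {k : ℝ} {y : E d} (h : ∀ x ∈ Metric.ball y k, v x = 0) :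
    ballAverage v k y = 0 := by
  refine integral_eq_zero_of_ae (ae_ballMeasure fun ξ hξ => ?_)
  exact h _ (by simpa using hξ)

/-- A majorant of `|v(x) - m|²` for all averages `m` over balls `B(y, k)` with `|y - x| ≤ 2 h`. -/
noncomputable def averageMajorant (v : E d → ℝ) (k h : ℝ) (x : E d) : ℝ≥0∞ :=
  2 * (∫⁻ ξ, ‖v (x + ξ) - v x‖ₑ ^ 2 ∂(ballMeasure d k)) +
    8 * ENNReal.ofReal h ^ 2 * ((volume (Metric.ball (0 : E d) k))⁻¹ *
      ∫⁻ y in Metric.ball x (3 * h), ‖fderiv ℝ v y‖ₑ ^ 2)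

lemma enorm_add_sq_le_two (a b : ℝ) : ‖a + b‖ₑ ^ 2 ≤ 2 * ‖a‖ₑ ^ 2 + 2 * ‖b‖ₑ ^ 2 := by
  have h : ∀ c : ℝ, ‖c‖ₑ ^ 2 = ENNReal.ofReal (c ^ 2) := fun c => by
    rw [← ofReal_norm, ← ENNReal.ofReal_pow (norm_nonneg _), Real.norm_eq_abs, sq_abs]
  rw [h, h, h, show (2 : ℝ≥0∞) = ENNReal.ofReal 2 by simp,
    ← ENNReal.ofReal_mul (by norm_num), ← ENNReal.ofReal_mul (by norm_num),
    ← ENNReal.ofReal_add (by positivity) (by positivity)]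
  exact ENNReal.ofReal_le_ofReal (by nlinarith [sq_nonneg (a - b)])

/-- Passing from `v x` to `v (y + ξ)` through `v (x + ξ)` separates the variables: the first
increment does not see `y`, and the second is an integral of the derivative over segments that stay
in `B(x, 3h)`. Averaging over `ξ` removes the remaining dependence on `y`, so the bound is uniform
over the admissible centres. -/
lemma enorm_sub_ballAverage_sq_le (hv : ContDiff ℝ 1 v) (hs : HasCompactSupport v) {k h : ℝ}
    (hk : 0 < k) (hkh : k ≤ h) {x y : E d} (hxy : dist y x ≤ 2 * h) :
    ‖v x - ballAverage v k y‖ₑ ^ 2 ≤ averageMajorant v k h x := by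
  have := isProbabilityMeasure_ballMeasure (d := d) hk
  have hh : 0 < h := hk.trans_le hkh
  have hvc := hv.continuous
  have hint : Integrable (fun ξ => v (y + ξ)) (ballMeasure d k) := by
    obtain ⟨C, hC⟩ := hvc.bounded_above_of_compact_support hs
    exact Integrable.of_bound (by fun_prop) C (.of_forall fun ξ => hC _)
  have e1 : v x - ballAverage v k y = ∫ ξ, (v x - v (y + ξ)) ∂(ballMeasure d k) := by
    rw [integral_sub (integrable_const _) hint]
    simp [ballAverage]
  rw [e1]
  refine (enorm_integral_sq_le _ (by fun_prop)).trans ?_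
  have e2 : ∀ ξ, ‖v x - v (y + ξ)‖ₑ ^ 2 ≤
      2 * ‖v (x + ξ) - v x‖ₑ ^ 2 + 2 * ‖v (y + ξ) - v (x + ξ)‖ₑ ^ 2 := by
    intro ξ
    have := enorm_add_sq_le_two (v x - v (x + ξ)) (v (x + ξ) - v (y + ξ))
    simp only [sub_add_sub_cancel] at this
    rwa [← enorm_neg (v x - v (x + ξ)), neg_sub, ← enorm_neg (v (x + ξ) - v (y + ξ)),
      neg_sub] at this
  refine (lintegral_mono e2).trans ?_
  rw [lintegral_add_left ((by fun_prop : Continuous fun ξ => ‖v (x + ξ) - v x‖ₑ ^ 2).measurable.const_mul 2),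
    lintegral_const_mul' _ _ (by simp), lintegral_const_mul' _ _ (by simp), averageMajorant]
  refine add_le_add_right ?_ _
  have e3 : ∀ ξ, ‖v (y + ξ) - v (x + ξ)‖ₑ ^ 2 ≤
      ENNReal.ofReal (2 * h) ^ 2 *
        ∫⁻ s in Icc (0 : ℝ) 1, ‖fderiv ℝ v (x + ξ + s • (y - x))‖ₑ ^ 2 := by
    intro ξ
    have := enorm_add_sub_sq_le hv (x + ξ) (y - x)
    rw [show x + ξ + (y - x) = y + ξ by abel] at this
    refine this.trans ?_
    gcongr
    rw [← ofReal_norm, ← dist_eq_norm]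
    exact ENNReal.ofReal_le_ofReal hxy
  have e4 : ∀ s ∈ Icc (0 : ℝ) 1,
      ∫⁻ ξ, ‖fderiv ℝ v (x + ξ + s • (y - x))‖ₑ ^ 2 ∂(ballMeasure d k) ≤
        (volume (Metric.ball (0 : E d) k))⁻¹ *
          ∫⁻ y in Metric.ball x (3 * h), ‖fderiv ℝ v y‖ₑ ^ 2 := by
    intro s hs
    rw [ballMeasure, lintegral_smul_measure, smul_eq_mul]
    refine mul_le_mul_right ?_ _
    rw [← lintegral_indicator Metric.isOpen_ball.measurableSet,
      ← lintegral_indicator Metric.isOpen_ball.measurableSet,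
      ← lintegral_add_right_eq_self ((Metric.ball x (3 * h)).indicator _) (x + s • (y - x))]
    refine lintegral_mono fun ξ => ?_
    simp only [indicator]
    split_ifs with h1 h2
    · rw [show x + ξ + s • (y - x) = ξ + (x + s • (y - x)) by abel]
    · exfalso
      apply h2
      rw [Metric.mem_ball, dist_eq_norm, show ξ + (x + s • (y - x)) - x = ξ + s • (y - x) by abel]
      rw [mem_ball_zero_iff] at h1
      rw [dist_eq_norm] at hxy
      have h3 : ‖s • (y - x)‖ ≤ 2 * h := by
        rw [norm_smul, Real.norm_of_nonneg hs.1]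
        nlinarith [hs.2, norm_nonneg (y - x)]
      linarith [norm_add_le ξ (s • (y - x))]
    · positivity
    · exact le_rfl
  -- The constant 8 is `2 * 2 ^ 2`: the 2 from splitting the square, the `2 ^ 2` from `|y - x| ≤ 2
  -- h`.
  calc 2 * ∫⁻ ξ, ‖v (y + ξ) - v (x + ξ)‖ₑ ^ 2 ∂(ballMeasure d k)
      ≤ 2 * ∫⁻ ξ, ENNReal.ofReal (2 * h) ^ 2 *
        (∫⁻ s in Icc (0 : ℝ) 1, ‖fderiv ℝ v (x + ξ + s • (y - x))‖ₑ ^ 2) ∂(ballMeasure d k) := by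
        gcongr with ξ
        exact e3 ξ
    _ = 8 * ENNReal.ofReal h ^ 2 * ∫⁻ s in Icc (0 : ℝ) 1,
        ∫⁻ ξ, ‖fderiv ℝ v (x + ξ + s • (y - x))‖ₑ ^ 2 ∂(ballMeasure d k) := by
        rw [lintegral_const_mul' _ _ (by finiteness), lintegral_lintegral_swap,
          ENNReal.ofReal_mul (by norm_num), mul_pow, ← mul_assoc, ← mul_assoc]
        · norm_num
        · exact ((measurable_enorm_fderiv_sq hv).comp
            (by fun_prop : Measurable fun p : E d × ℝ => x + p.1 + p.2 • (y - x))).aemeasurable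
    _ ≤ 8 * ENNReal.ofReal h ^ 2 * ∫⁻ _s in Icc (0 : ℝ) 1,
        ((volume (Metric.ball (0 : E d) k))⁻¹ *
          ∫⁻ y in Metric.ball x (3 * h), ‖fderiv ℝ v y‖ₑ ^ 2) := by
        gcongr 1
        exact setLIntegral_mono' measurableSet_Icc e4
    _ = _ := by simp

/-- The translation estimate controls the first summand. In the second, Fubini turns the integral
over moving balls into a factor `|B(0, 3h)|`, and its quotient by `|B(0, κh)|` is the scale-free
constant `(3/κ)^d`. -/
lemma lintegral_averageMajorant_le (hd : 1 ≤ d) (hv : ContDiff ℝ 1 v) {κ h : ℝ}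
    (hκ : 0 < κ) (hκ1 : κ ≤ 1) (hh : 0 < h) :
    ∫⁻ x, averageMajorant v (κ * h) h x ≤
      ENNReal.ofReal (h ^ 2 * (2 + 8 * (3 / κ) ^ d)) * ∫⁻ x, ‖fderiv ℝ v x‖ₑ ^ 2 := by
  have hk : 0 < κ * h := by positivity
  have hkh : κ * h ≤ h := by nlinarith
  have : Nonempty (Fin d) := ⟨⟨0, hd⟩⟩
  have := isProbabilityMeasure_ballMeasure (d := d) hk
  have hvc := hv.continuous
  set G := ∫⁻ x, ‖fderiv ℝ v x‖ₑ ^ 2 with hG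
  have m1 : Measurable (Function.uncurry fun x ξ : E d => ‖v (x + ξ) - v x‖ₑ ^ 2) := by
    apply Continuous.measurable
    simp only [Function.uncurry_def]
    fun_prop
  have s1 : ∫⁻ x, ∫⁻ ξ, ‖v (x + ξ) - v x‖ₑ ^ 2 ∂(ballMeasure d (κ * h)) ≤
      ENNReal.ofReal h ^ 2 * G := by
    rw [lintegral_lintegral_swap m1.aemeasurable]
    calc _ ≤ ∫⁻ _ξ, ENNReal.ofReal h ^ 2 * G ∂(ballMeasure d (κ * h)) := by
          refine lintegral_mono_ae (ae_ballMeasure fun ξ hξ => ?_)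
          refine (lintegral_translate_sub_le hv ξ).trans ?_
          gcongr
          rw [← ofReal_norm]
          exact ENNReal.ofReal_le_ofReal (by linarith)
      _ = _ := by simp
  have s2 : ∫⁻ x, ∫⁻ y in Metric.ball x (3 * h), ‖fderiv ℝ v y‖ₑ ^ 2 =
      volume (Metric.ball (0 : E d) (3 * h)) * G := by
    have : ∀ x : E d, ∫⁻ y in Metric.ball x (3 * h), ‖fderiv ℝ v y‖ₑ ^ 2 =
        ∫⁻ y, (Metric.ball (0 : E d) (3 * h)).indicator 1 (x - y) * ‖fderiv ℝ v y‖ₑ ^ 2 := by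
      intro x
      rw [← lintegral_indicator Metric.isOpen_ball.measurableSet]
      refine lintegral_congr fun y => ?_
      simp only [indicator, Metric.mem_ball, dist_eq_norm, norm_sub_rev y x, sub_zero]
      split_ifs <;> simp
    simp_rw [this]
    rw [lintegral_lintegral_swap]
    · rw [hG, ← lintegral_const_mul' _ _ measure_ball_lt_top.ne]
      refine lintegral_congr fun y => ?_
      rw [lintegral_mul_const' _ _ (by simp)]
      congr 1
      rw [lintegral_sub_right_eq_self (fun x => (Metric.ball (0 : E d) (3 * h)).indicator
        (1 : E d → ℝ≥0∞) x) y, lintegral_indicator_one Metric.isOpen_ball.measurableSet]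
    · refine Measurable.aemeasurable (Measurable.mul ?_ ?_)
      · exact (measurable_one.indicator Metric.isOpen_ball.measurableSet).comp
          (by fun_prop : Measurable fun p : E d × E d => p.1 - p.2)
      · exact (measurable_enorm_fderiv_sq hv).comp measurable_snd
  have vol : (volume (Metric.ball (0 : E d) (κ * h)))⁻¹ * volume (Metric.ball (0 : E d) (3 * h)) =
      ENNReal.ofReal ((3 / κ) ^ d) := by
    have e : 3 * h = (3 / κ) * (κ * h) := by field_simp
    have e2 : volume (Metric.ball (0 : E d) (3 * h)) =
        ENNReal.ofReal ((3 / κ) ^ d) * volume (Metric.ball (0 : E d) (κ * h)) := by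
      rw [Measure.addHaar_ball volume _ (by positivity : (0 : ℝ) ≤ 3 * h),
        Measure.addHaar_ball volume _ hk.le, ← mul_assoc, ← ENNReal.ofReal_mul (by positivity),
        e]
      simp [mul_pow]
    rw [e2, mul_left_comm, ENNReal.inv_mul_cancel (Metric.measure_ball_pos _ _ hk).ne'
      measure_ball_lt_top.ne, mul_one]
  unfold averageMajorant
  rw [lintegral_add_left, lintegral_const_mul' _ _ (by simp),
    lintegral_const_mul' _ _ (by finiteness), lintegral_const_mul', s2, ← mul_assoc _ _ G, vol]
  · calc _ ≤ 2 * (ENNReal.ofReal h ^ 2 * G) +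
        8 * ENNReal.ofReal h ^ 2 * (ENNReal.ofReal ((3 / κ) ^ d) * G) := by gcongr
      _ = (ENNReal.ofReal h ^ 2 * (2 + 8 * ENNReal.ofReal ((3 / κ) ^ d))) * G := by ring
      _ = _ := by
        rw [ENNReal.ofReal_mul (by positivity), ENNReal.ofReal_add (by norm_num) (by positivity),
          ENNReal.ofReal_mul (by norm_num), ENNReal.ofReal_pow hh.le]
        simp
  · exact ENNReal.inv_ne_top.2 (Metric.measure_ball_pos _ _ hk).ne'
  · exact (m1.lintegral_prod_right').const_mul 2

/-- A function whose value at `x` is a convex combination of averages of `v` over balls of radius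
`κ h` centred within `2 h` of `x` approximates `v` to first order in `L²`. -/
lemma lintegral_sub_sq_le_of_ballAverage (hd : 1 ≤ d) (hv : ContDiff ℝ 1 v)
    (hs : HasCompactSupport v) {κ h : ℝ} (hκ : 0 < κ) (hκ1 : κ ≤ 1) (hh : 0 < h)
    {Ω : Set (E d)} (hΩ : MeasurableSet Ω) {w : E d → ℝ}
    (hw : ∀ x ∈ Ω, w x ∈ convexHull ℝ
      (ballAverage v (κ * h) '' Metric.closedBall x (2 * h))) :
    ∫⁻ x in Ω, ‖v x - w x‖ₑ ^ 2 ≤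
      ENNReal.ofReal (h ^ 2 * (2 + 8 * (3 / κ) ^ d)) * ∫⁻ x, ‖fderiv ℝ v x‖ₑ ^ 2 := by
  refine le_trans ?_ (lintegral_averageMajorant_le hd hv hκ hκ1 hh)
  refine le_trans ?_ (setLIntegral_le_lintegral Ω _)
  refine setLIntegral_mono' hΩ fun x hx => ?_
  -- The majorant does not depend on the centre, so the admissible values `t` form a ball about `v
  -- x` or all of `ℝ`; a convex set containing the averages contains `w x`.
  have hconv : Convex ℝ {t : ℝ | ‖v x - t‖ₑ ^ 2 ≤ averageMajorant v (κ * h) h x} := by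
    have : {t : ℝ | ‖v x - t‖ₑ ^ 2 ≤ averageMajorant v (κ * h) h x} =
        {t : ℝ | edist t (v x) ≤ averageMajorant v (κ * h) h x ^ (1 / 2 : ℝ)} := by
      ext t
      rw [mem_ofPred_eq, mem_ofPred_eq, edist_comm, edist_eq_enorm_sub, one_div,
        ENNReal.le_rpow_inv_iff (by norm_num)]
      norm_num
    rw [this]
    by_cases htop : averageMajorant v (κ * h) h x ^ (1 / 2 : ℝ) = ⊤
    · rw [htop]
      simpa using convex_univ
    · have : {t : ℝ | edist t (v x) ≤ averageMajorant v (κ * h) h x ^ (1 / 2 : ℝ)} =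
          Metric.closedBall (v x) (averageMajorant v (κ * h) h x ^ (1 / 2 : ℝ)).toReal := by
        ext t
        rw [mem_ofPred_eq, Metric.mem_closedBall, dist_edist,
          ENNReal.toReal_le_toReal (edist_ne_top _ _) htop]
      rw [this]
      exact convex_closedBall _ _
  refine convexHull_min ?_ hconv (hw x hx)
  rintro _ ⟨y, hy, rfl⟩
  exact enorm_sub_ballAverage_sq_le hv hs (by positivity) (by nlinarith) hy

end Averages

/-! ### Lipschitz domains -/

section Domain

variable {d : ℕ} {Ω : Set (E d)}

lemma IsBoundedLipschitzDomain.notMem_of_mem_frontier (hΩ : IsBoundedLipschitzDomain Ω) {z : E d}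
    (hz : z ∈ frontier Ω) : z ∉ Ω := by
  rw [hΩ.isOpen.frontier_eq] at hz
  exact hz.2

/-- The uniform exterior ball (cone) condition. -/
lemma IsBoundedLipschitzDomain.exists_exterior_ball (hΩ : IsBoundedLipschitzDomain Ω) :
    ∃ h₀ : ℝ, 0 < h₀ ∧ ∃ κ : ℝ, 0 < κ ∧ κ ≤ 1 ∧ ∀ z ∈ frontier Ω, ∀ h : ℝ, 0 < h → h ≤ h₀ →
      ∃ y, dist y z ≤ h ∧ ∀ x ∈ Metric.ball y (κ * h), x ∉ Ω := by
  have hcomp : IsCompact (frontier Ω) :=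
    Metric.isCompact_of_isClosed_isBounded isClosed_frontier
      (hΩ.isBounded.closure.subset frontier_subset_closure)
  -- The doubled membership prepares the compactness induction, whose sets `s` need not be contained
  -- in the frontier.
  suffices H : ∃ h₀ : ℝ, 0 < h₀ ∧ ∃ κ : ℝ, 0 < κ ∧ κ ≤ 1 ∧ ∀ z ∈ frontier Ω, z ∈ frontier Ω →
      ∀ h : ℝ, 0 < h → h ≤ h₀ → ∃ y, dist y z ≤ h ∧ ∀ x ∈ Metric.ball y (κ * h), x ∉ Ω by
    obtain ⟨h₀, h1, κ, h2, h3, h4⟩ := H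
    exact ⟨h₀, h1, κ, h2, h3, fun z hz => h4 z hz hz⟩
  refine hcomp.induction_on (p := fun s => ∃ h₀ : ℝ, 0 < h₀ ∧ ∃ κ : ℝ, 0 < κ ∧ κ ≤ 1 ∧
    ∀ z ∈ s, z ∈ frontier Ω → ∀ h : ℝ, 0 < h → h ≤ h₀ →
      ∃ y, dist y z ≤ h ∧ ∀ x ∈ Metric.ball y (κ * h), x ∉ Ω) ?_ ?_ ?_ ?_
  · exact ⟨1, one_pos, 1, one_pos, le_rfl, by simp⟩
  · rintro s t hst ⟨h₀, h1, κ, h2, h3, h4⟩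
    exact ⟨h₀, h1, κ, h2, h3, fun z hz => h4 z (hst hz)⟩
  · rintro s t ⟨h₀, h1, κ, h2, h3, h4⟩ ⟨h₀', h1', κ', h2', h3', h4'⟩
    refine ⟨min h₀ h₀', lt_min h1 h1', min κ κ', lt_min h2 h2', (min_le_left _ _).trans h3, ?_⟩
    rintro z (hz | hz) hzf h hh hle
    · obtain ⟨y, hy, hb⟩ := h4 z hz hzf h hh (hle.trans (min_le_left _ _))
      refine ⟨y, hy, fun x hx => hb x (Metric.ball_subset_ball ?_ hx)⟩
      gcongr
      exact min_le_left _ _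
    · obtain ⟨y, hy, hb⟩ := h4' z hz hzf h hh (hle.trans (min_le_right _ _))
      refine ⟨y, hy, fun x hx => hb x (Metric.ball_subset_ball ?_ hx)⟩
      gcongr
      exact min_le_right _ _
  · intro x₀ hx₀
    obtain ⟨n, g, K, hn, hg, hgn, U, hU, hUΩ⟩ := hΩ.lipschitz x₀ hx₀
    obtain ⟨δ, hδ, hball⟩ := Metric.mem_nhds_iff.1 hU
    refine ⟨Metric.ball x₀ (δ / 3), mem_nhdsWithin_of_mem_nhds (Metric.ball_mem_nhds _ (by linarith)),
      δ / 3, by linarith, (1 + K : ℝ)⁻¹, by positivity, inv_le_one_of_one_le₀ (by simp), ?_⟩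
    intro z hz hzf h hh hle
    have hκ : (1 + K : ℝ)⁻¹ * h ≤ h := by
      have : (1 + K : ℝ)⁻¹ ≤ 1 := inv_le_one_of_one_le₀ (by simp)
      nlinarith
    have hzU : z ∈ U := hball (Metric.ball_subset_ball (by linarith) hz)
    have hzg : inner ℝ n z ≤ g z := by
      by_contra! hcon
      exact hΩ.notMem_of_mem_frontier hzf ((hUΩ z hzU).2 hcon)
    -- Moving by `h` against `n` lowers the height by `h` and keeps `g`. Within distance `δ` of the
    -- new point, height and graph together change by at most `(1 + K) δ`, hence the radius `h / (1
    -- + K)`.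
    refine ⟨z + (-h) • n, ?_, fun x hx hxΩ => ?_⟩
    · simp [norm_smul, hn, abs_of_pos hh]
    · rw [Metric.mem_ball] at hx hz
      have hyz : dist (z + (-h) • n) z = h := by simp [norm_smul, hn, abs_of_pos hh]
      have hxU : x ∈ U := by
        apply hball
        rw [Metric.mem_ball]
        calc dist x x₀ ≤ dist x (z + (-h) • n) + dist (z + (-h) • n) z + dist z x₀ :=
              dist_triangle4 _ _ _ _
          _ < δ := by linarith
      have h1 := (hUΩ x hxU).1 hxΩ
      have h2 := hg.dist_le_mul (z + (-h) • n) x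
      rw [hgn, Real.dist_eq, dist_comm] at h2
      have h3 : inner ℝ n x = inner ℝ n z - h + inner ℝ n (x - (z + (-h) • n)) := by
        rw [inner_sub_right, inner_add_right, inner_smul_right, real_inner_self_eq_norm_sq, hn]
        ring
      have h4 : inner ℝ n (x - (z + (-h) • n)) ≤ dist x (z + (-h) • n) := by
        rw [dist_eq_norm]
        simpa [hn] using real_inner_le_norm n (x - (z + (-h) • n))
      have h5 : (1 + K : ℝ) * dist x (z + (-h) • n) < h := by
        rw [inv_mul_eq_div, lt_div_iff₀ (by positivity)] at hx
        linarith
      linarith [le_abs_self (g z - g x)]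

/-- A Lipschitz domain has no slits: an exterior ball near a boundary point would otherwise lie
inside the closure. This transfers information from the mesh, which only covers the closure, to `Ω`.
-/
lemma IsBoundedLipschitzDomain.interior_closure_subset (hΩ : IsBoundedLipschitzDomain Ω) :
    interior (closure Ω) ⊆ Ω := by
  intro x hx
  by_contra hxΩ
  have hxf : x ∈ frontier Ω := by
    rw [hΩ.isOpen.frontier_eq]
    exact ⟨interior_subset hx, hxΩ⟩
  obtain ⟨h₀, hh₀, κ, hκ, -, hball⟩ := hΩ.exists_exterior_ball
  obtain ⟨δ, hδ, hsub⟩ := Metric.mem_nhds_iff.1 (mem_interior_iff_mem_nhds.1 hx)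
  have hm : 0 < min h₀ (δ / 2) := lt_min hh₀ (by linarith)
  obtain ⟨y, hy, hyΩ⟩ := hball x hxf (min h₀ (δ / 2)) hm (min_le_left _ _)
  have hyc : y ∈ closure Ω := hsub (by
    rw [Metric.mem_ball]
    linarith [min_le_right h₀ (δ / 2)])
  obtain ⟨p, hpΩ, hp⟩ := Metric.mem_closure_iff.1 hyc (κ * min h₀ (δ / 2)) (by positivity)
  exact hyΩ p (by rwa [Metric.mem_ball, dist_comm]) hpΩ

end Domain

/-! ### Nodal functions -/

namespace Mesh

variable {d : ℕ} {Ω : Set (E d)} (𝒯 : Mesh Ω)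

lemma cellBasis_apply {T : Finset (E d)} (hT : T ∈ 𝒯.cells) (y : T) :
    𝒯.cellBasis T hT y = (y : E d) := rfl

lemma range_cellBasis {T : Finset (E d)} (hT : T ∈ 𝒯.cells) :
    range (𝒯.cellBasis T hT) = (T : Set (E d)) := by
  ext x
  simp [cellBasis_apply]

lemma mem_simplex_iff {T : Finset (E d)} (hT : T ∈ 𝒯.cells) {x : E d} :
    x ∈ simplex T ↔ ∀ i, 0 ≤ (𝒯.cellBasis T hT).coord i x := by
  rw [simplex, ← 𝒯.range_cellBasis hT, AffineBasis.convexHull_eq_nonneg_coord]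
  rfl

lemma isClosed_simplex (T : Finset (E d)) : IsClosed (simplex T) :=
  (T.finite_toSet.isCompact_convexHull ℝ).isClosed

lemma isBounded_simplex (T : Finset (E d)) : Bornology.IsBounded (simplex T) :=
  (T.finite_toSet.isCompact_convexHull ℝ).isBounded

lemma subset_simplex (T : Finset (E d)) {z : E d} (hz : z ∈ T) : z ∈ simplex T :=
  subset_convexHull ℝ _ hz

lemma coord_vertex {T : Finset (E d)} (hT : T ∈ 𝒯.cells) (z : T) {y : E d} (hy : y ∈ T) :
    (𝒯.cellBasis T hT).coord z y = if (z : E d) = y then 1 else 0 := by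
  have := (𝒯.cellBasis T hT).coord_apply z ⟨y, hy⟩
  rw [cellBasis_apply] at this
  simpa [Subtype.ext_iff] using this

lemma convex_eqLocus (f g : E d →ᵃ[ℝ] ℝ) : Convex ℝ {x | f x = g x} := by
  intro x hx y hy a b _ _ hab
  have hx' : f x = g x := hx
  have hy' : f y = g y := hy
  change f _ = g _
  rw [Convex.combo_affine_apply hab, Convex.combo_affine_apply hab, hx', hy']

/-- By conformity `x` is in the hull of the common vertices, where two affine functions agree once
they agree at those vertices. It makes the choice of cell in `hat` harmless. -/
lemma coord_eq_coord {S T : Finset (E d)} (hS : S ∈ 𝒯.cells) (hT : T ∈ 𝒯.cells) {z x : E d}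
    (hzS : z ∈ S) (hzT : z ∈ T) (hxS : x ∈ simplex S) (hxT : x ∈ simplex T) :
    (𝒯.cellBasis S hS).coord ⟨z, hzS⟩ x = (𝒯.cellBasis T hT).coord ⟨z, hzT⟩ x := by
  have hx : x ∈ convexHull ℝ ((S : Set (E d)) ∩ T) := by
    rw [← 𝒯.conforming S hS T hT]
    exact ⟨hxS, hxT⟩
  refine convexHull_min ?_ (convex_eqLocus ((𝒯.cellBasis S hS).coord ⟨z, hzS⟩)
    ((𝒯.cellBasis T hT).coord ⟨z, hzT⟩)) hx
  rintro y ⟨hyS, hyT⟩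
  rw [mem_ofPred_eq, 𝒯.coord_vertex hS _ hyS, 𝒯.coord_vertex hT _ hyT]

lemma coord_eq_zero {S T : Finset (E d)} (hS : S ∈ 𝒯.cells) (hT : T ∈ 𝒯.cells) {z x : E d}
    (hzS : z ∈ S) (hzT : z ∉ T) (hxS : x ∈ simplex S) (hxT : x ∈ simplex T) :
    (𝒯.cellBasis S hS).coord ⟨z, hzS⟩ x = 0 := by
  have hx : x ∈ convexHull ℝ ((S : Set (E d)) ∩ T) := by
    rw [← 𝒯.conforming S hS T hT]
    exact ⟨hxS, hxT⟩
  refine convexHull_min ?_ (convex_eqLocus ((𝒯.cellBasis S hS).coord ⟨z, hzS⟩)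
    (0 : E d →ᵃ[ℝ] ℝ)) hx
  rintro y ⟨hyS, hyT⟩
  rw [mem_ofPred_eq, 𝒯.coord_vertex hS _ hyS, if_neg]
  · rfl
  · rintro rfl
    exact hzT hyT

lemma mem_of_mem_simplex {S T : Finset (E d)} (hS : S ∈ 𝒯.cells) (hT : T ∈ 𝒯.cells) {z : E d}
    (hzS : z ∈ S) (hzT : z ∈ simplex T) : z ∈ T := by
  by_contra h
  have := 𝒯.coord_eq_zero hS hT hzS h (subset_simplex S hzS) hzT
  simp [𝒯.coord_vertex hS _ hzS] at this

lemma hat_eq_coord {T : Finset (E d)} (hT : T ∈ 𝒯.cells) {z x : E d} (hz : z ∈ T)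
    (hx : x ∈ simplex T) : 𝒯.hat z x = (𝒯.cellBasis T hT).coord ⟨z, hz⟩ x := by
  have h : ∃ T, ∃ _ : T ∈ 𝒯.cells, ∃ _ : z ∈ T, x ∈ simplex T := ⟨T, hT, hz, hx⟩
  rw [hat, dif_pos h]
  exact 𝒯.coord_eq_coord _ hT _ hz h.choose_spec.choose_spec.choose_spec hx

lemma hat_eq_zero_of_notMem {T : Finset (E d)} (hT : T ∈ 𝒯.cells) {z x : E d} (hz : z ∉ T)
    (hx : x ∈ simplex T) : 𝒯.hat z x = 0 := by
  rw [hat]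
  split_ifs with h
  · exact 𝒯.coord_eq_zero _ hT _ hz h.choose_spec.choose_spec.choose_spec hx
  · rfl

lemma hat_eq_zero_of_forall {z x : E d} (h : ∀ T ∈ 𝒯.cells, z ∈ T → x ∉ simplex T) :
    𝒯.hat z x = 0 := by
  rw [hat, dif_neg]
  rintro ⟨T, hT, hz, hx⟩
  exact h T hT hz hx

lemma hat_nonneg (z x : E d) : 0 ≤ 𝒯.hat z x := by
  by_cases h : ∃ T ∈ 𝒯.cells, z ∈ T ∧ x ∈ simplex T
  · obtain ⟨T, hT, hz, hx⟩ := h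
    rw [𝒯.hat_eq_coord hT hz hx]
    exact (𝒯.mem_simplex_iff hT).1 hx _
  · push Not at h
    rw [𝒯.hat_eq_zero_of_forall h]

lemma exists_affine_hat {T : Finset (E d)} (hT : T ∈ 𝒯.cells) (z : E d) :
    ∃ f : E d →ᵃ[ℝ] ℝ, ∀ x ∈ simplex T, 𝒯.hat z x = f x := by
  by_cases hz : z ∈ T
  · exact ⟨_, fun x hx => 𝒯.hat_eq_coord hT hz hx⟩
  · exact ⟨0, fun x hx => by simp [𝒯.hat_eq_zero_of_notMem hT hz hx]⟩

lemma mem_interiorVertices {z : E d} :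
    z ∈ 𝒯.interiorVertices ↔ (∃ T ∈ 𝒯.cells, z ∈ T) ∧ z ∈ Ω := by
  simp [interiorVertices]

lemma hat_vertex {y z : E d} (hy : y ∈ 𝒯.interiorVertices) :
    𝒯.hat z y = if z = y then 1 else 0 := by
  obtain ⟨⟨T, hT, hyT⟩, -⟩ := 𝒯.mem_interiorVertices.1 hy
  by_cases hz : z ∈ T
  · rw [𝒯.hat_eq_coord hT hz (subset_simplex T hyT), 𝒯.coord_vertex hT _ hyT]
  · rw [𝒯.hat_eq_zero_of_notMem hT hz (subset_simplex T hyT), if_neg]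
    rintro rfl
    exact hz hyT

lemma exists_cell_of_mem {x : E d} (hx : x ∈ closure Ω) : ∃ T ∈ 𝒯.cells, x ∈ simplex T := by
  rw [← 𝒯.cover] at hx
  simpa using hx

lemma simplex_subset {T : Finset (E d)} (hT : T ∈ 𝒯.cells) : simplex T ⊆ closure Ω := by
  rw [← 𝒯.cover]
  exact subset_biUnion_of_mem (u := fun T => simplex T) hT

/-- Points near `x` lie only in cells that contain `x`. -/
lemma eventually_mem_simplex (x : E d) :
    ∀ᶠ y in nhds x, ∀ T ∈ 𝒯.cells, y ∈ simplex T → x ∈ simplex T := by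
  rw [Filter.eventually_all_finset]
  intro T _
  by_cases hx : x ∈ simplex T
  · exact .of_forall fun _ _ => hx
  · filter_upwards [(isClosed_simplex T).isOpen_compl.mem_nhds hx] with y hy hy'
    exact absurd hy' hy

/-- The cells around an interior vertex `z` fill a neighbourhood of `z`. If the nodal function is
nonzero at `x`, contracting a neighbourhood of `x` towards `z` brings it into this star. Since
contraction only rescales the coordinates other than that of `z`, the original neighbourhood was in
the star too. Thus `x` is interior to the closure of `Ω`. -/
lemma hat_eq_zero_of_notMem_domain (hΩ : IsBoundedLipschitzDomain Ω) {z x : E d} (hz : z ∈ Ω)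
    (hx : x ∉ Ω) : 𝒯.hat z x = 0 := by
  by_contra hne
  apply hx
  apply hΩ.interior_closure_subset
  rw [mem_interior_iff_mem_nhds]
  obtain ⟨T, hT, hzT, hxT⟩ : ∃ T ∈ 𝒯.cells, z ∈ T ∧ x ∈ simplex T := by
    by_contra! h
    exact hne (𝒯.hat_eq_zero_of_forall h)
  rw [𝒯.hat_eq_coord hT hzT hxT] at hne
  have hpos : 0 < (𝒯.cellBasis T hT).coord ⟨z, hzT⟩ x :=
    lt_of_le_of_ne ((𝒯.mem_simplex_iff hT).1 hxT _) (Ne.symm hne)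
  have hstar : ∀ᶠ p in nhds z, ∃ S ∈ 𝒯.cells, z ∈ S ∧ p ∈ simplex S := by
    filter_upwards [hΩ.isOpen.mem_nhds hz, 𝒯.eventually_mem_simplex z] with p hp hS
    obtain ⟨S, hSc, hpS⟩ := 𝒯.exists_cell_of_mem (subset_closure hp)
    exact ⟨S, hSc, 𝒯.mem_of_mem_simplex hT hSc hzT (hS S hSc hpS), hpS⟩
  -- The parameter `t` is taken so small that the contracted point still has a neighbourhood covered
  -- by the star of `z`.
  obtain ⟨t, ht0, ht1, ht⟩ : ∃ t : ℝ, 0 < t ∧ t ≤ 1 ∧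
      ∀ᶠ p in nhds (AffineMap.lineMap z x t), ∃ S ∈ 𝒯.cells, z ∈ S ∧ p ∈ simplex S := by
    have hc : Filter.Tendsto (fun t : ℝ => AffineMap.lineMap z x t) (nhds 0) (nhds z) := by
      have : Continuous (fun t : ℝ => AffineMap.lineMap z x t) := AffineMap.lineMap_continuous
      simpa using this.tendsto 0
    have h1 := (hc.eventually hstar.eventually_nhds).filter_mono
      (nhdsWithin_le_nhds : nhdsWithin (0 : ℝ) (Ioi 0) ≤ _)
    obtain ⟨t, h2, h3⟩ := (h1.and (Ioc_mem_nhdsGT (zero_lt_one (α := ℝ)))).exists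
    exact ⟨t, h3.1, h3.2, h2⟩
  have hq : Continuous (fun y : E d => AffineMap.lineMap z y t) := by
    simp only [AffineMap.lineMap_apply]
    fun_prop
  have hqT : AffineMap.lineMap z x t ∈ simplex T :=
    (convex_convexHull ℝ (T : Set (E d))).lineMap_mem (subset_simplex T hzT) hxT ⟨ht0.le, ht1⟩
  have hposS : ∀ᶠ y in nhds x, ∀ S : 𝒯.cells, ∀ hzS : z ∈ S.1,
      0 < (𝒯.cellBasis S.1 S.2).coord ⟨z, hzS⟩ x → 0 < (𝒯.cellBasis S.1 S.2).coord ⟨z, hzS⟩ y := by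
    rw [Filter.eventually_all]
    intro S
    rw [Filter.eventually_all]
    intro hzS
    by_cases h : 0 < (𝒯.cellBasis S.1 S.2).coord ⟨z, hzS⟩ x
    · have hc : Continuous ((𝒯.cellBasis S.1 S.2).coord ⟨z, hzS⟩) :=
        AffineMap.continuous_of_finiteDimensional _
      filter_upwards [hc.continuousAt (x := x) |>.eventually (lt_mem_nhds h)] with y hy _
      exact hy
    · exact .of_forall fun _ h' => absurd h' h
  filter_upwards [hq.continuousAt.eventually ht,
    hq.continuousAt.eventually (𝒯.eventually_mem_simplex (AffineMap.lineMap z x t)), hposS]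
    with y ⟨S, hS, hzS, hyS⟩ hxS hy
  apply 𝒯.simplex_subset hS
  have hxS' := hxS S hS hyS
  -- The cells `S` and `T` share the contracted point, and the `z`-coordinate there is `1 - t` plus
  -- `t` times the one at `x`; so the two `z`-coordinates also agree at `x`, although `x` is not yet
  -- known to lie in `S`.
  have key : 0 < (𝒯.cellBasis S hS).coord ⟨z, hzS⟩ x := by
    have := 𝒯.coord_eq_coord hS hT hzS hzT hxS' hqT
    rw [AffineMap.apply_lineMap, AffineMap.apply_lineMap, 𝒯.coord_vertex hS _ hzS,
      𝒯.coord_vertex hT _ hzT] at this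
    simp only [AffineMap.lineMap_apply, vsub_eq_sub, smul_eq_mul, vadd_eq_add, if_true] at this
    have h2 := mul_left_cancel₀ ht0.ne' (add_right_cancel this)
    linarith
  rw [𝒯.mem_simplex_iff hS]
  intro i
  by_cases hi : (i : E d) = z
  · have : i = ⟨z, hzS⟩ := Subtype.ext hi
    rw [this]
    exact (hy ⟨S, hS⟩ hzS key).le
  · have := (𝒯.mem_simplex_iff hS).1 hyS i
    rw [AffineMap.apply_lineMap, 𝒯.coord_vertex hS _ hzS, if_neg hi] at this
    simp only [AffineMap.lineMap_apply, vsub_eq_sub, smul_eq_mul, vadd_eq_add, sub_zero,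
      add_zero] at this
    exact nonneg_of_mul_nonneg_right this ht0

/-- A mean value inequality on segments: the local bounds control the right difference quotients of
`f` along the segment, with no differentiability needed. -/
lemma lipschitzWith_of_eventually {f : E d → ℝ} {L : NNReal}
    (h : ∀ x, ∀ᶠ y in nhds x, |f y - f x| ≤ L * ‖y - x‖) : LipschitzWith L f := by
  have main : ∀ x y, f y ≤ f x + L * ‖y - x‖ := by
    intro x y
    have hcf : Continuous f := by
      rw [continuous_iff_continuousAt]
      intro x
      rw [ContinuousAt, tendsto_iff_dist_tendsto_zero]
      refine squeeze_zero' (.of_forall fun _ => dist_nonneg)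
        (g := fun y => L * ‖y - x‖) (h x) ?_
      have : Continuous fun y : E d => (L : ℝ) * ‖y - x‖ := by fun_prop
      simpa using this.tendsto x
    have hq : Continuous (fun t : ℝ => x + t • (y - x)) := by fun_prop
    have := image_le_of_liminf_slope_right_le_deriv_boundary
      (f := fun t : ℝ => f (x + t • (y - x))) (a := 0) (b := 1)
      (B := fun t => f x + (L * ‖y - x‖) * t) (B' := fun _ => L * ‖y - x‖)
      (hcf.comp hq).continuousOn (by simp) (by fun_prop)
      (fun t _ => by
        simpa using (((hasDerivAt_id t).const_mul (L * ‖y - x‖)).const_add (f x)).hasDerivWithinAt)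
      (fun t _ r hr => by
        refine Filter.Eventually.frequently ?_
        have h1 := (hq.continuousAt (x := t)).eventually (h (x + t • (y - x)))
        filter_upwards [nhdsWithin_le_nhds h1, self_mem_nhdsWithin] with s hs hst
        have hst' : 0 < s - t := sub_pos.2 hst
        rw [slope_def_field, div_lt_iff₀ hst']
        have e : x + s • (y - x) - (x + t • (y - x)) = (s - t) • (y - x) := by module
        rw [e, norm_smul, Real.norm_of_nonneg hst'.le] at hs
        have := (abs_le.1 hs).2
        nlinarith)
      (right_mem_Icc.2 zero_le_one)
    simpa using this
  refine LipschitzWith.of_dist_le_mul fun x y => ?_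
  rw [Real.dist_eq, abs_le, dist_eq_norm]
  have h1 := main x y
  have h2 := main y x
  rw [norm_sub_rev] at h1
  constructor <;> linarith

/-- Near `x` every cell met also contains `x`, so one affine piece joins the values at `x` and at a
nearby point; off `Ω` the function is zero. The sum of the norms of all pieces serves as a common
constant. -/
lemma exists_lipschitzWith_hat (hΩ : IsBoundedLipschitzDomain Ω) {z : E d} (hz : z ∈ Ω) :
    ∃ L : NNReal, LipschitzWith L (𝒯.hat z) := by
  choose f hf using fun T : 𝒯.cells => 𝒯.exists_affine_hat T.2 z
  refine ⟨∑ T, ‖(f T).linear.toContinuousLinearMap‖₊, lipschitzWith_of_eventually fun x => ?_⟩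
  have hcell : ∀ᶠ y in nhds x, y ∈ closure Ω → |𝒯.hat z y - 𝒯.hat z x| ≤
      (∑ T, ‖(f T).linear.toContinuousLinearMap‖₊ : NNReal) * ‖y - x‖ := by
    filter_upwards [𝒯.eventually_mem_simplex x] with y hy hyΩ
    obtain ⟨T, hT, hyT⟩ := 𝒯.exists_cell_of_mem hyΩ
    rw [hf ⟨T, hT⟩ y hyT, hf ⟨T, hT⟩ x (hy T hT hyT)]
    have e : f ⟨T, hT⟩ y - f ⟨T, hT⟩ x =
        (f ⟨T, hT⟩).linear.toContinuousLinearMap (y - x) := by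
      simp [← vsub_eq_sub, AffineMap.linearMap_vsub]
    rw [e, ← Real.norm_eq_abs]
    refine (ContinuousLinearMap.le_opNorm _ _).trans ?_
    gcongr
    rw [← coe_nnnorm, NNReal.coe_le_coe]
    exact Finset.single_le_sum (f := fun T => ‖(f T).linear.toContinuousLinearMap‖₊)
      (fun _ _ => zero_le) (Finset.mem_univ (⟨T, hT⟩ : 𝒯.cells))
  by_cases hx : x ∈ Ω
  · filter_upwards [hcell, hΩ.isOpen.mem_nhds hx] with y hy hyΩ
    exact hy (subset_closure hyΩ)
  · filter_upwards [hcell] with y hy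
    by_cases hyΩ : y ∈ Ω
    · exact hy (subset_closure hyΩ)
    · rw [𝒯.hat_eq_zero_of_notMem_domain hΩ hz hx, 𝒯.hat_eq_zero_of_notMem_domain hΩ hz hyΩ]
      simp only [sub_self, abs_zero]
      positivity

/-! ### Mesh size and nodal combinations -/

lemma diam_le_size {T : Finset (E d)} (hT : T ∈ 𝒯.cells) : Metric.diam (simplex T) ≤ 𝒯.size :=
  le_ciSup (f := fun T : 𝒯.cells => Metric.diam (simplex (T : Finset (E d))))
    (finite_range _).bddAbove ⟨T, hT⟩

lemma dist_le_size {T : Finset (E d)} (hT : T ∈ 𝒯.cells) {x y : E d} (hx : x ∈ simplex T)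
    (hy : y ∈ simplex T) : dist x y ≤ 𝒯.size :=
  (Metric.dist_le_diam_of_mem (isBounded_simplex T) hx hy).trans (𝒯.diam_le_size hT)

lemma size_pos (hd : 1 ≤ d) (hΩ : IsBoundedLipschitzDomain Ω) : 0 < 𝒯.size := by
  obtain ⟨x, hx⟩ := hΩ.isConnected.nonempty
  obtain ⟨T, hT, -⟩ := 𝒯.exists_cell_of_mem (subset_closure hx)
  have : 1 < T.card := by rw [𝒯.card_eq T hT]; omega
  obtain ⟨a, ha, b, hb, hab⟩ := Finset.one_lt_card.1 this
  exact (dist_pos.2 hab).trans_le (𝒯.dist_le_size hT (subset_simplex T ha) (subset_simplex T hb))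

open Classical in
/-- A nodal combination takes values in the convex hull of its nodal values, where the nodal value
at a vertex outside `Ω` is zero. -/
lemma sum_hat_mem_convexHull {T : Finset (E d)} (hT : T ∈ 𝒯.cells) {x : E d} (hx : x ∈ simplex T)
    (m : E d → ℝ) {s : Set ℝ} (hin : ∀ z ∈ T, z ∈ Ω → m z ∈ s) (hout : ∀ z ∈ T, z ∉ Ω → 0 ∈ s) :
    ∑ z ∈ 𝒯.interiorVertices, m z * 𝒯.hat z x ∈ convexHull ℝ s := by
  have e : ∑ z ∈ 𝒯.interiorVertices, m z * 𝒯.hat z x =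
      ∑ z : T, (𝒯.cellBasis T hT).coord z x • (if (z : E d) ∈ Ω then m z else 0) := by
    have e1 : ∀ z : T, (𝒯.cellBasis T hT).coord z x • (if (z : E d) ∈ Ω then m z else 0) =
        (fun z : E d => if z ∈ Ω then m z * 𝒯.hat z x else 0) z := by
      intro z
      simp only [𝒯.hat_eq_coord hT z.2 hx]
      split_ifs <;> simp [mul_comm]
    rw [Finset.sum_congr rfl (fun z _ => e1 z),
      Finset.sum_coe_sort T (fun z : E d => if z ∈ Ω then m z * 𝒯.hat z x else 0),
      ← Finset.sum_filter]
    symm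
    refine Finset.sum_subset ?_ ?_
    · intro z hz
      rw [Finset.mem_filter] at hz
      exact 𝒯.mem_interiorVertices.2 ⟨⟨T, hT, hz.1⟩, hz.2⟩
    · intro z hz hz'
      rw [Finset.mem_filter] at hz'
      have : z ∉ T := fun h => hz' ⟨h, (𝒯.mem_interiorVertices.1 hz).2⟩
      rw [𝒯.hat_eq_zero_of_notMem hT this hx, mul_zero]
  rw [e]
  refine (convex_convexHull ℝ s).sum_mem (fun z _ => (𝒯.mem_simplex_iff hT).1 hx z)
    ((𝒯.cellBasis T hT).sum_coord_apply_eq_one x) fun z _ => subset_convexHull ℝ s ?_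
  split_ifs with h
  · exact hin z z.2 h
  · exact hout z z.2 h

end Mesh

/-! ### Bounded sequences in Hilbert spaces -/

/-- The image of a closed ball of a Hilbert space under a bounded operator is closed. -/
lemma exists_apply_eq_of_bounded_of_tendsto {H F : Type*} [NormedAddCommGroup H]
    [InnerProductSpace ℝ H] [CompleteSpace H] [NormedAddCommGroup F] [NormedSpace ℝ F]
    (T : H →L[ℝ] F) {p : ℕ → H} {M : ℝ} (hM : ∀ n, ‖p n‖ ≤ M) {f : F}
    (hf : Filter.Tendsto (fun n => T (p n)) Filter.atTop (nhds f)) : ∃ q, T q = f := by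
  -- A replacement for weak compactness: the elements of least norm in the closed convex hulls of
  -- the tails have increasing bounded norms, and the parallelogram law makes them a Cauchy
  -- sequence. Its limit is mapped to `f`.
  let K : ℕ → Set H := fun n => closure (convexHull ℝ (p '' Ici n))
  have hKc : ∀ n, Convex ℝ (K n) := fun n => (convex_convexHull ℝ _).closure
  have hpK : ∀ n, p n ∈ K n := fun n =>
    subset_closure (subset_convexHull ℝ _ (mem_image_of_mem p self_mem_Ici))
  have hanti : Antitone K := fun n m h =>
    closure_mono (convexHull_mono (image_mono (Ici_subset_Ici.2 h)))
  have hex : ∀ n, ∃ q ∈ K n, ∀ w ∈ K n, ‖q‖ ≤ ‖w‖ := by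
    intro n
    obtain ⟨q, hq, hmin⟩ := exists_norm_eq_iInf_of_complete_convex ⟨_, hpK n⟩
      (isClosed_closure.isComplete : IsComplete (K n)) (hKc n) 0
    refine ⟨q, hq, fun w hw => ?_⟩
    simp only [zero_sub, norm_neg] at hmin
    rw [hmin]
    exact ciInf_le ⟨0, by rintro _ ⟨w, rfl⟩; positivity⟩ (⟨w, hw⟩ : K n)
  choose q hqK hqmin using hex
  have hmono : Monotone fun n => ‖q n‖ ^ 2 := fun n m h => by
    have := hqmin n (q m) (hanti h (hqK m))
    simp only
    gcongr
  have hbdd : BddAbove (range fun n => ‖q n‖ ^ 2) := by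
    refine ⟨M ^ 2, ?_⟩
    rintro _ ⟨n, rfl⟩
    simp only
    gcongr
    exact (hqmin n _ (hpK n)).trans (hM n)
  have htend := tendsto_atTop_ciSup hmono hbdd
  set s := ⨆ n, ‖q n‖ ^ 2 with hs
  have hle : ∀ n, ‖q n‖ ^ 2 ≤ s := fun n => le_ciSup hbdd n
  have hdist : ∀ n m N, N ≤ n → N ≤ m → dist (q n) (q m) ≤ √(4 * (s - ‖q N‖ ^ 2)) := by
    intro n m N hn hm
    rw [dist_eq_norm]
    apply Real.le_sqrt_of_sq_le
    have hmid : (2⁻¹ : ℝ) • q n + (2⁻¹ : ℝ) • q m ∈ K N :=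
      hKc N (hanti hn (hqK n)) (hanti hm (hqK m)) (by norm_num) (by norm_num) (by norm_num)
    have h1 := hqmin N _ hmid
    rw [← smul_add, norm_smul] at h1
    have h2 : ‖q N‖ ^ 2 ≤ (2⁻¹ * ‖q n + q m‖) ^ 2 := by
      gcongr
      simpa using h1
    have := parallelogram_law_with_norm ℝ (q n) (q m)
    nlinarith [hle n, hle m]
  have hcau : CauchySeq q := by
    refine cauchySeq_of_le_tendsto_0 _ hdist ?_
    have : Filter.Tendsto (fun n => √(4 * (s - ‖q n‖ ^ 2))) Filter.atTop
        (nhds (√(4 * (s - s)))) :=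
      ((tendsto_const_nhds.sub htend).const_mul 4).sqrt
    simpa using this
  obtain ⟨q', hq'⟩ := cauchySeq_tendsto_of_complete hcau
  refine ⟨q', tendsto_nhds_unique ((T.continuous.tendsto q').comp hq') ?_⟩
  rw [Metric.tendsto_atTop]
  intro ε hε
  obtain ⟨N, hN⟩ := Metric.tendsto_atTop.1 hf (ε / 2) (by linarith)
  refine ⟨N, fun n hn => ?_⟩
  have hsub : K n ⊆ T ⁻¹' Metric.closedBall f (ε / 2) := by
    refine closure_minimal (convexHull_min ?_ ?_) (Metric.isClosed_closedBall.preimage T.continuous)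
    · rintro _ ⟨m, hm, rfl⟩
      exact (hN m (le_trans hn hm)).le
    · exact (convex_closedBall f (ε / 2)).linear_preimage T.toLinearMap
  have := hsub (hqK n)
  rw [mem_preimage, Metric.mem_closedBall] at this
  simp only [Function.comp]
  linarith

/-! ### Smooth approximation of Lipschitz functions -/

/-- A nonnegative Lipschitz function that vanishes off a bounded open set is a uniform limit of test
functions with the same Lipschitz constant. -/
lemma exists_testFunction_near {d : ℕ} {Ω : Set (E d)} (ho : IsOpen Ω)
    (hb : Bornology.IsBounded Ω) {f : E d → ℝ} {L : NNReal} (hf : LipschitzWith L f)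
    (h0 : ∀ x, 0 ≤ f x) (hz : ∀ x, x ∉ Ω → f x = 0) {ε : ℝ} (hε : 0 < ε) :
    ∃ φ : E d → ℝ, ContDiff ℝ ∞ φ ∧ HasCompactSupport φ ∧ tsupport φ ⊆ Ω ∧ LipschitzWith L φ ∧
      ∀ x, |φ x - f x| ≤ 2 * ε := by
  -- Truncation moves the support into the compact set `{ε ≤ f} ⊆ Ω`, leaving room to mollify
  -- without enlarging the Lipschitz constant.
  set g : E d → ℝ := fun x => max (f x - ε) 0 with hg
  have hgL : LipschitzWith L g := by
    have h1 : LipschitzWith L (fun x => f x - ε) := by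
      refine LipschitzWith.of_dist_le_mul fun x y => ?_
      simpa using hf.dist_le_mul x y
    exact h1.max_const 0
  have hgf : ∀ x, |g x - f x| ≤ ε := fun x => by
    rw [abs_le, hg]
    simp only
    constructor
    · linarith [le_max_left (f x - ε) 0]
    · rcases max_cases (f x - ε) 0 with h | h <;> linarith [h0 x]
  set K : Set (E d) := {x | ε ≤ f x} with hK
  have hKΩ : K ⊆ Ω := fun x hx => by
    by_contra h
    have : ε ≤ f x := hx
    rw [hz x h] at this
    linarith
  have hKc : IsCompact K := Metric.isCompact_of_isClosed_isBounded
    (isClosed_le continuous_const hf.continuous) (hb.subset hKΩ)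
  have hgK : Function.support g ⊆ K := fun x hx => by
    by_contra h
    have : f x < ε := not_le.1 h
    exact hx (max_eq_right (by linarith))
  obtain ⟨δ, hδ, hδΩ⟩ := hKc.exists_cthickening_subset_open ho hKΩ
  -- The first bound keeps the mollified support inside `Ω`; the second makes mollification change
  -- `g` by at most `ε`.
  set r : ℝ := min δ (ε / (L + 1)) with hr
  have hr0 : 0 < r := lt_min hδ (by positivity)
  let φ : ContDiffBump (0 : E d) := ⟨r / 2, r, by linarith, by linarith⟩
  set ψ := convolution (φ.normed volume) g (ContinuousLinearMap.lsmul ℝ ℝ) volume with hψ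
  have hsupp : Function.support ψ ⊆ Metric.cthickening δ K := by
    refine (support_convolution_subset _).trans ?_
    rintro _ ⟨a, ha, b, hb, rfl⟩
    rw [φ.support_normed_eq] at ha
    refine Metric.mem_cthickening_of_dist_le _ b _ _ (hgK hb) ?_
    have : ‖a‖ < r := by simpa using ha
    simp only [dist_add_self_left]
    exact this.le.trans (min_le_left _ _)
  have htsupp : tsupport ψ ⊆ Metric.cthickening δ K :=
    closure_minimal hsupp Metric.isClosed_cthickening
  have hint : ∀ x, Integrable (fun t => φ.normed volume t * g (x - t)) := fun x =>
    (φ.continuous_normed.mul (hgL.continuous.comp (by fun_prop))).integrable_of_hasCompactSupport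
      φ.hasCompactSupport_normed.mul_right
  refine ⟨ψ, ?_, ?_, htsupp.trans hδΩ, ?_, ?_⟩
  · exact φ.hasCompactSupport_normed.contDiff_convolution_left _ φ.contDiff_normed
      hgL.continuous.locallyIntegrable
  · exact hKc.cthickening.of_isClosed_subset (isClosed_tsupport ψ) htsupp
  · refine LipschitzWith.of_dist_le_mul fun x y => ?_
    rw [Real.dist_eq, hψ, convolution_def, convolution_def]
    simp only [ContinuousLinearMap.lsmul_apply, smul_eq_mul]
    rw [← integral_sub (hint x) (hint y), ← Real.norm_eq_abs]
    calc _ ≤ ∫ t, φ.normed volume t * (L * dist x y) := by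
          refine norm_integral_le_of_norm_le
            (φ.integrable_normed.mul_const _) (.of_forall fun t => ?_)
          rw [← mul_sub, norm_mul, Real.norm_of_nonneg (φ.nonneg_normed t)]
          refine mul_le_mul_of_nonneg_left ?_ (φ.nonneg_normed t)
          simpa [Real.dist_eq] using hgL.dist_le_mul (x - t) (y - t)
      _ = L * dist x y := by rw [integral_mul_const, φ.integral_normed, one_mul]
  · intro x
    have h1 : dist (ψ x) (g x) ≤ ε := by
      refine φ.dist_normed_convolution_le hgL.continuous.aestronglyMeasurable fun y hy => ?_
      refine (hgL.dist_le_mul y x).trans ?_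
      have hy' : dist y x < r := hy
      have h2 : r ≤ ε / (L + 1) := min_le_right _ _
      rw [le_div_iff₀ (by positivity)] at h2
      nlinarith [L.coe_nonneg, dist_nonneg (x := y) (y := x)]
    rw [Real.dist_eq] at h1
    have := abs_add_le (ψ x - g x) (g x - f x)
    rw [sub_add_sub_cancel] at this
    linarith [hgf x]

/-! ### The space `H¹₀` -/

section H10

variable {d : ℕ} {Ω : Set (E d)}

/-- The function underlying an element of `H¹₀(Ω)`, as an element of `L²(Ω)`. -/
noncomputable def fnL (Ω : Set (E d)) : V Ω →L[ℝ] Lp ℝ 2 (volume.restrict Ω) :=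
  (WithLp.fstL 2 ℝ _ _).comp (H10 Ω).subtypeL

/-- The weak gradient of an element of `H¹₀(Ω)`, as an element of `L²(Ω; ℝᵈ)`. -/
noncomputable def gradL (Ω : Set (E d)) : V Ω →L[ℝ] Lp (E d) 2 (volume.restrict Ω) :=
  (WithLp.sndL 2 ℝ _ _).comp (H10 Ω).subtypeL

lemma coeFn_fnL (u : V Ω) : (fnL Ω u : E d → ℝ) = u.fn := rfl

lemma coeFn_gradL (u : V Ω) : (gradL Ω u : E d → E d) = u.grad := rfl

lemma norm_sq_eq (u : V Ω) : ‖u‖ ^ 2 = ‖fnL Ω u‖ ^ 2 + ‖gradL Ω u‖ ^ 2 :=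
  WithLp.prod_norm_sq_eq_of_L2 (u : L2Pair Ω)

instance : CompleteSpace (V Ω) :=
  (Submodule.isClosed_topologicalClosure _).completeSpace_coe

lemma l2_eq_inner (u v : V Ω) : l2 u v = inner ℝ (fnL Ω u) (fnL Ω v) := by
  rw [L2.inner_def]
  refine integral_congr_ae (.of_forall fun x => ?_)
  simp [coeFn_fnL, mul_comm]

lemma l2norm_eq_norm (u : V Ω) : l2norm u = ‖fnL Ω u‖ := by
  rw [l2norm, l2_eq_inner, real_inner_self_eq_norm_sq, Real.sqrt_sq (norm_nonneg _)]

lemma enorm_sq_eq_lintegral {F : Type*} [NormedAddCommGroup F] {X : Type*} [MeasurableSpace X]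
    {μ : Measure X} {f : Lp F 2 μ} {g : X → F} (h : f =ᵐ[μ] g) :
    ‖f‖ₑ ^ 2 = ∫⁻ x, ‖g x‖ₑ ^ 2 ∂μ := by
  rw [Lp.enorm_def, eLpNorm_congr_ae h,
    eLpNorm_eq_lintegral_rpow_enorm_toReal (by norm_num) (by norm_num), ← ENNReal.rpow_natCast,
    ← ENNReal.rpow_mul]
  simp

lemma continuous_gradient {φ : E d → ℝ} (h : ContDiff ℝ ∞ φ) : Continuous (gradient φ) :=
  (InnerProductSpace.toDual ℝ (E d)).symm.continuous.comp (h.continuous_fderiv (by simp))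

lemma norm_gradient (φ : E d → ℝ) (x : E d) : ‖gradient φ x‖ = ‖fderiv ℝ φ x‖ := by
  rw [gradient, LinearIsometryEquiv.norm_map]

lemma hasCompactSupport_gradient {φ : E d → ℝ} (h : HasCompactSupport φ) :
    HasCompactSupport (gradient φ) :=
  (h.fderiv ℝ).comp_left (g := (InnerProductSpace.toDual ℝ (E d)).symm) (map_zero _)

lemma exists_testPair {φ : E d → ℝ} (h : ContDiff ℝ ∞ φ) (hc : HasCompactSupport φ)
    (hs : tsupport φ ⊆ Ω) : ∃ u : V Ω, u.fn =ᵐ[volume.restrict Ω] φ ∧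
      u.grad =ᵐ[volume.restrict Ω] gradient φ := by
  have h1 : MemLp φ 2 (volume.restrict Ω) := h.continuous.memLp_of_hasCompactSupport hc
  have h2 : MemLp (gradient φ) 2 (volume.restrict Ω) :=
    (continuous_gradient h).memLp_of_hasCompactSupport (hasCompactSupport_gradient hc)
  let p : L2Pair Ω := WithLp.toLp 2 (h1.toLp φ, h2.toLp (gradient φ))
  have hp : p ∈ testPairs Ω := ⟨φ, h, hc, hs, h1.coeFn_toLp, h2.coeFn_toLp⟩
  exact ⟨⟨p, Submodule.le_topologicalClosure _ (Submodule.subset_span hp)⟩,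
    h1.coeFn_toLp, h2.coeFn_toLp⟩

/-- Density arguments may thus be run on single test functions instead of linear combinations. -/
lemma mem_testPairs_of_mem_span {p : L2Pair Ω} (hp : p ∈ Submodule.span ℝ (testPairs Ω)) :
    p ∈ testPairs Ω := by
  induction hp using Submodule.span_induction with
  | mem p hp => exact hp
  | zero =>
    refine ⟨0, contDiff_const, HasCompactSupport.zero, by simp, ?_, ?_⟩
    · exact Lp.coeFn_zero _ _ _
    · refine (Lp.coeFn_zero _ _ _).trans (.of_forall fun x => ?_)
      simp [gradient]
  | add p q _ _ hp hq =>
    obtain ⟨φ, h1, h2, h3, h4, h5⟩ := hp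
    obtain ⟨ψ, k1, k2, k3, k4, k5⟩ := hq
    refine ⟨φ + ψ, h1.add k1, h2.add k2, (tsupport_add φ ψ).trans (union_subset h3 k3), ?_, ?_⟩
    · exact (Lp.coeFn_add _ _).trans (h4.add k4)
    · refine ((Lp.coeFn_add _ _).trans (h5.add k5)).trans (.of_forall fun x => ?_)
      simp only [Pi.add_apply, gradient]
      rw [fderiv_add (h1.differentiable (by simp) x) (k1.differentiable (by simp) x), map_add]
  | smul c p _ hp =>
    obtain ⟨φ, h1, h2, h3, h4, h5⟩ := hp
    refine ⟨c • φ, h1.const_smul c, h2.smul_left (f := fun _ => c), ?_, ?_, ?_⟩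
    · exact (closure_mono (Function.support_const_smul_subset c φ)).trans h3
    · exact (Lp.coeFn_smul _ _).trans (h4.const_smul c)
    · refine ((Lp.coeFn_smul _ _).trans (h5.const_smul c)).trans (.of_forall fun x => ?_)
      simp only [Pi.smul_apply, gradient]
      rw [fderiv_const_smul (h1.differentiable (by simp) x), map_smul]

/-- A closed property of pairs that holds for test functions holds on `H¹₀(Ω)`. -/
lemma V.induction_of_isClosed {P : L2Pair Ω → Prop} (hP : IsClosed {p | P p})
    (h : ∀ p ∈ testPairs Ω, P p) (u : V Ω) : P u :=
  closure_minimal (fun p hp => h p (mem_testPairs_of_mem_span hp)) hP u.2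

lemma lintegral_enorm_fderiv_eq (ho : IsOpen Ω) {φ : E d → ℝ} (hs : tsupport φ ⊆ Ω) :
    ∫⁻ x, ‖fderiv ℝ φ x‖ₑ ^ 2 = ∫⁻ x in Ω, ‖gradient φ x‖ₑ ^ 2 := by
  have : ∀ x, ‖gradient φ x‖ₑ ^ 2 = ‖fderiv ℝ φ x‖ₑ ^ 2 := fun x => by
    rw [← ofReal_norm, ← ofReal_norm, norm_gradient]
  simp_rw [this]
  rw [← lintegral_indicator ho.measurableSet]
  refine lintegral_congr fun x => ?_
  by_cases hx : x ∈ Ω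
  · rw [indicator_of_mem hx]
  · have : fderiv ℝ φ x = 0 := image_eq_zero_of_notMem_tsupport fun h =>
      hx (hs (tsupport_fderiv_subset ℝ h))
    rw [indicator_of_notMem hx, this, ← ofReal_norm, norm_zero]
    simp

/-- Friedrichs' inequality in `H¹₀(Ω)`. -/
lemma exists_norm_fnL_le (hd : 1 ≤ d) (ho : IsOpen Ω) (hb : Bornology.IsBounded Ω) :
    ∃ D : ℝ, 0 < D ∧ ∀ u : V Ω, ‖fnL Ω u‖ ≤ D * ‖gradL Ω u‖ := by
  obtain ⟨D, hD⟩ := Metric.isBounded_iff.1 hb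
  refine ⟨|D| + 1, by positivity, fun u => ?_⟩
  refine V.induction_of_isClosed (P := fun p => ‖p.fst‖ ≤ (|D| + 1) * ‖p.snd‖) ?_ ?_ u
  · exact isClosed_le (WithLp.fstL 2 ℝ _ _).continuous.norm
      (continuous_const.mul (WithLp.sndL 2 ℝ _ _).continuous.norm)
  · rintro p ⟨φ, h1, h2, h3, h4, h5⟩
    have := lintegral_sq_le_of_dist_le hd (h1.of_le (by simp)) (D := |D| + 1) (by positivity)
      (fun x hx y hy => by linarith [hD hx hy, le_abs_self D])
      (fun x hx => image_eq_zero_of_notMem_tsupport fun h => hx (h3 h))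
    rw [lintegral_enorm_fderiv_eq ho h3, ← enorm_sq_eq_lintegral h5] at this
    have h6 : ‖p.fst‖ₑ ^ 2 ≤ (ENNReal.ofReal (|D| + 1) * ‖p.snd‖ₑ) ^ 2 := by
      rw [enorm_sq_eq_lintegral h4, mul_pow]
      exact (setLIntegral_le_lintegral _ _).trans this
    have h7 := (ENNReal.pow_le_pow_left_iff (by norm_num)).1 h6
    rw [← ofReal_norm, ← ofReal_norm, ← ENNReal.ofReal_mul (by positivity)] at h7
    exact (ENNReal.ofReal_le_ofReal_iff (by positivity)).1 h7

/-- Nonnegative Lipschitz functions that vanish off `Ω` belong to `H¹₀(Ω)`. -/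
lemma exists_fn_eq_of_lipschitzWith (ho : IsOpen Ω) (hb : Bornology.IsBounded Ω) {f : E d → ℝ}
    {L : NNReal} (hf : LipschitzWith L f) (h0 : ∀ x, 0 ≤ f x) (hz : ∀ x, x ∉ Ω → f x = 0) :
    ∃ u : V Ω, u.fn =ᵐ[volume.restrict Ω] f := by
  have : IsFiniteMeasure (volume.restrict Ω) := ⟨by simpa using hb.measure_lt_top⟩
  have hcs : HasCompactSupport f := by
    refine (Metric.isCompact_of_isClosed_isBounded isClosed_closure hb.closure).of_isClosed_subset
      (isClosed_tsupport f) (closure_mono fun x hx => ?_)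
    by_contra h
    exact hx (hz x h)
  obtain ⟨B, hB⟩ := hf.continuous.bounded_above_of_compact_support hcs
  have hB0 : 0 ≤ B := (norm_nonneg _).trans (hB 0)
  have hmem : MemLp f 2 (volume.restrict Ω) := hf.continuous.memLp_of_hasCompactSupport hcs
  choose φ h1 h2 h3 h4 h5 using fun n : ℕ =>
    exists_testFunction_near ho hb hf h0 hz (ε := 1 / ((n : ℝ) + 1)) (by positivity)
  choose u hu hg using fun n => exists_testPair (h1 n) (h2 n) (h3 n)
  set m : ℝ := (measureUnivNNReal (volume.restrict Ω) : ℝ) ^ (2 : ℝ≥0∞).toReal⁻¹ with hm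
  have hm0 : 0 ≤ m := by positivity
  have hε1 : ∀ n : ℕ, 1 / ((n : ℝ) + 1) ≤ 1 := fun n => by
    rw [div_le_one (by positivity)]
    linarith [n.cast_nonneg (α := ℝ)]
  -- The approximants converge only in `L²`; the common Lipschitz constant bounds their gradients,
  -- and boundedness in `H¹` suffices to find a limit in `H¹₀`.
  obtain ⟨q, hq⟩ := exists_apply_eq_of_bounded_of_tendsto (fnL Ω) (p := u)
    (M := m * (B + 2) + m * L) (f := hmem.toLp f) (fun n => by
      have e1 : ‖fnL Ω (u n)‖ ≤ m * (B + 2) := by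
        refine Lp.norm_le_of_ae_bound (by positivity) ?_
        filter_upwards [hu n] with x hx
        rw [coeFn_fnL, hx]
        have := abs_sub_abs_le_abs_sub (φ n x) (f x)
        rw [Real.norm_eq_abs]
        have h6 := hB x
        rw [Real.norm_eq_abs] at h6
        linarith [h5 n x, hε1 n]
      have e2 : ‖gradL Ω (u n)‖ ≤ m * L := by
        refine Lp.norm_le_of_ae_bound (by positivity) ?_
        filter_upwards [hg n] with x hx
        rw [coeFn_gradL, hx, norm_gradient]
        exact norm_fderiv_le_of_lipschitz ℝ (h4 n)
      have e3 := norm_sq_eq (u n)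
      refine abs_le_of_sq_le_sq' (a := ‖u n‖) ?_ (by positivity) |>.2
      nlinarith [norm_nonneg (fnL Ω (u n)), norm_nonneg (gradL Ω (u n)),
        mul_le_mul e1 e1 (norm_nonneg _) (by positivity),
        mul_le_mul e2 e2 (norm_nonneg _) (by positivity),
        mul_nonneg (by positivity : 0 ≤ m * (B + 2)) (by positivity : 0 ≤ m * (L : ℝ))]) (by
      rw [tendsto_iff_norm_sub_tendsto_zero]
      refine squeeze_zero (fun _ => norm_nonneg _) (g := fun n : ℕ => m * (2 * (1 / ((n : ℝ) + 1))))
        (fun n => ?_) ?_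
      · refine Lp.norm_le_of_ae_bound (by positivity) ?_
        filter_upwards [hu n, hmem.coeFn_toLp, Lp.coeFn_sub (fnL Ω (u n)) (hmem.toLp f)]
          with x hx hx' hx''
        rw [hx'', Pi.sub_apply, hx', coeFn_fnL, hx]
        exact h5 n x
      · simpa using (tendsto_one_div_add_atTop_nhds_zero_nat (𝕜 := ℝ)).const_mul 2 |>.const_mul m)
  refine ⟨q, ?_⟩
  rw [← coeFn_fnL, hq]
  exact hmem.coeFn_toLp

end H10

/-! ### The energy form -/

/-- The Lax-Milgram projection onto a closed subspace. -/
lemma exists_projection_of_coercive {H : Type*} [NormedAddCommGroup H] [InnerProductSpace ℝ H]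
    [CompleteSpace H] (B : H →L[ℝ] H →L[ℝ] ℝ) (hB : ∃ m : ℝ, 0 < m ∧ ∀ u, m * ‖u‖ * ‖u‖ ≤ B u u)
    (F : Submodule ℝ H) (hF : IsClosed (F : Set H)) (w : H) :
    ∃ p ∈ F, ∀ q ∈ F, B p q = B w q := by
  have : CompleteSpace F := hF.completeSpace_coe
  let BF : F →L[ℝ] F →L[ℝ] ℝ := B.bilinearComp F.subtypeL F.subtypeL
  have hco : IsCoercive BF := by
    obtain ⟨m, hm, h⟩ := hB
    exact ⟨m, hm, fun u => h u⟩
  let p : F := hco.continuousLinearEquivOfBilin.symm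
    ((InnerProductSpace.toDual ℝ F).symm ((B w).comp F.subtypeL))
  refine ⟨p, p.2, fun q hq => ?_⟩
  have := hco.continuousLinearEquivOfBilin_apply p ⟨q, hq⟩
  simp only [p, ContinuousLinearEquiv.apply_symm_apply, InnerProductSpace.toDual_symm_apply] at this
  exact this.symm

section Energy

variable {d : ℕ} {Ω : Set (E d)} {A : E d → Matrix (Fin d) (Fin d) ℝ} {α β : ℝ}

lemma dotProduct_bounds {M : Matrix (Fin d) (Fin d) ℝ} (hs : M.IsSymm)
    (hM : spectrum ℝ M ⊆ Icc α β) (x : Fin d → ℝ) :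
    α * (x ⬝ᵥ x) ≤ (M *ᵥ x) ⬝ᵥ x ∧ (M *ᵥ x) ⬝ᵥ x ≤ β * (x ⬝ᵥ x) := by
  have hH : M.IsHermitian := hs
  have hc : ∀ r : ℝ, (algebraMap ℝ (Matrix (Fin d) (Fin d) ℝ) r).IsHermitian := fun r => by
    rw [Matrix.algebraMap_eq_diagonal]
    exact Matrix.isHermitian_diagonal _
  have hmul : ∀ r : ℝ, algebraMap ℝ (Matrix (Fin d) (Fin d) ℝ) r *ᵥ x = r • x := fun r => by
    rw [Algebra.algebraMap_eq_smul_one, Matrix.smul_mulVec, Matrix.one_mulVec]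
  -- Shifting by the endpoints of the interval turns the spectral inclusion into positive
  -- semidefiniteness.
  have h1 : (M - algebraMap ℝ _ α).PosSemidef := by
    rw [Matrix.posSemidef_iff_isHermitian_and_spectrum_nonneg]
    refine ⟨hH.sub (hc α), ?_⟩
    rw [← spectrum.sub_singleton_eq]
    rintro _ ⟨a, ha, _, rfl, rfl⟩
    exact sub_nonneg.2 (hM ha).1
  have h2 : (algebraMap ℝ _ β - M).PosSemidef := by
    rw [Matrix.posSemidef_iff_isHermitian_and_spectrum_nonneg]
    refine ⟨(hc β).sub hH, ?_⟩
    rw [← spectrum.singleton_sub_eq]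
    rintro _ ⟨_, rfl, a, ha, rfl⟩
    exact sub_nonneg.2 (hM ha).2
  have k1 := h1.dotProduct_mulVec_nonneg x
  have k2 := h2.dotProduct_mulVec_nonneg x
  simp only [star_trivial, Matrix.sub_mulVec, hmul, dotProduct_sub, dotProduct_smul,
    smul_eq_mul] at k1 k2
  rw [dotProduct_comm (M *ᵥ x) x]
  constructor <;> linarith

lemma dotProduct_comm_of_isSymm {M : Matrix (Fin d) (Fin d) ℝ} (hs : M.IsSymm) (x y : Fin d → ℝ) :
    (M *ᵥ x) ⬝ᵥ y = (M *ᵥ y) ⬝ᵥ x := by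
  rw [dotProduct_comm, Matrix.dotProduct_mulVec, ← Matrix.mulVec_transpose, hs.eq]

/-- Nonnegativity of the form at `x + y` and `x - y` suffices; the crude constant only serves
integrability. -/
lemma abs_dotProduct_le {M : Matrix (Fin d) (Fin d) ℝ} (hs : M.IsSymm) (hα : 0 ≤ α)
    (hM : spectrum ℝ M ⊆ Icc α β) (x y : Fin d → ℝ) :
    |(M *ᵥ x) ⬝ᵥ y| ≤ β * (x ⬝ᵥ x + y ⬝ᵥ y) := by
  have hnn : ∀ z : Fin d → ℝ, 0 ≤ (M *ᵥ z) ⬝ᵥ z := fun z =>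
    (mul_nonneg hα (by simpa using dotProduct_star_self_nonneg z)).trans
      (dotProduct_bounds hs hM z).1
  have h1 := hnn (x + y)
  have h2 := hnn (x - y)
  have hx := (dotProduct_bounds hs hM x).2
  have hy := (dotProduct_bounds hs hM y).2
  have hx0 := hnn x
  have hy0 := hnn y
  simp only [Matrix.mulVec_add, Matrix.mulVec_sub, dotProduct_add, add_dotProduct, dotProduct_sub,
    sub_dotProduct, dotProduct_comm_of_isSymm hs y x] at h1 h2
  rw [abs_le]
  constructor <;> nlinarith

lemma ofLp_dotProduct_self (x : E d) : x.ofLp ⬝ᵥ x.ofLp = ‖x‖ ^ 2 := by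
  rw [EuclideanSpace.norm_sq_eq, dotProduct]
  exact Finset.sum_congr rfl fun i _ => by rw [Real.norm_eq_abs, sq_abs, sq]

lemma integrable_norm_grad_sq (u : V Ω) :
    Integrable (fun x => ‖u.grad x‖ ^ 2) (volume.restrict Ω) :=
  (Lp.memLp (gradL Ω u)).integrable_norm_pow (by norm_num)

lemma integral_norm_grad_sq (u : V Ω) : ∫ x in Ω, ‖u.grad x‖ ^ 2 = ‖gradL Ω u‖ ^ 2 := by
  rw [← real_inner_self_eq_norm_sq, L2.inner_def]
  refine integral_congr_ae (.of_forall fun x => ?_)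
  simp only [real_inner_self_eq_norm_sq]
  rfl

lemma IsCoefficient.integrable (hA : IsCoefficient Ω A α β) (u v : V Ω) :
    Integrable (fun x => (A x *ᵥ (u.grad x).ofLp) ⬝ᵥ (v.grad x).ofLp) (volume.restrict Ω) := by
  have hm : ∀ (w : V Ω) (i : Fin d),
      AEMeasurable (fun x => (w.grad x).ofLp i) (volume.restrict Ω) := fun w i =>
    (by fun_prop : Measurable fun y : E d => y.ofLp i).comp_aemeasurable
      (Lp.aestronglyMeasurable (gradL Ω w)).aemeasurable
  refine Integrable.mono' (g := fun x => β * (‖u.grad x‖ ^ 2 + ‖v.grad x‖ ^ 2))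
    (((integrable_norm_grad_sq u).add (integrable_norm_grad_sq v)).const_mul β) ?_ ?_
  · apply AEMeasurable.aestronglyMeasurable
    simp only [dotProduct, Matrix.mulVec]
    exact Finset.aemeasurable_fun_sum _ fun i _ => (Finset.aemeasurable_fun_sum _ fun j _ =>
      (hA.measurable i j).mul (hm u j)).mul (hm v i)
  · filter_upwards [hA.symm, hA.spectrum_subset] with x h1 h2
    rw [Real.norm_eq_abs, ← ofLp_dotProduct_self, ← ofLp_dotProduct_self]
    exact abs_dotProduct_le h1 hA.pos.le h2 _ _

lemma IsCoefficient.aform_comm (hA : IsCoefficient Ω A α β) (u v : V Ω) :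
    aform A u v = aform A v u := by
  refine integral_congr_ae ?_
  filter_upwards [hA.symm] with x h1
  exact dotProduct_comm_of_isSymm h1 _ _

lemma IsCoefficient.aform_add_left (hA : IsCoefficient Ω A α β) (u u' v : V Ω) :
    aform A (u + u') v = aform A u v + aform A u' v := by
  rw [aform, aform, aform, ← integral_add (hA.integrable u v) (hA.integrable u' v)]
  refine integral_congr_ae ?_
  have := Lp.coeFn_add (gradL Ω u) (gradL Ω u')
  rw [← map_add] at this
  simp only [coeFn_gradL] at this
  filter_upwards [this] with x hx
  rw [hx, Pi.add_apply, WithLp.ofLp_add, Matrix.mulVec_add, add_dotProduct]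

lemma aform_smul_left (c : ℝ) (u v : V Ω) : aform A (c • u) v = c * aform A u v := by
  rw [aform, aform, ← integral_const_mul]
  refine integral_congr_ae ?_
  have := Lp.coeFn_smul c (gradL Ω u)
  rw [← map_smul] at this
  simp only [coeFn_gradL] at this
  filter_upwards [this] with x hx
  rw [hx, Pi.smul_apply, WithLp.ofLp_smul, Matrix.mulVec_smul, smul_dotProduct, smul_eq_mul]

/-- The energy form as a bilinear map. -/
noncomputable def IsCoefficient.bilin (hA : IsCoefficient Ω A α β) :
    V Ω →ₗ[ℝ] V Ω →ₗ[ℝ] ℝ :=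
  LinearMap.mk₂ ℝ (aform A) hA.aform_add_left (fun c u v => aform_smul_left c u v)
    (fun u v v' => by
      rw [hA.aform_comm u, hA.aform_add_left, hA.aform_comm u v, hA.aform_comm u v'])
    (fun c u v => by rw [hA.aform_comm u, aform_smul_left, hA.aform_comm u v, smul_eq_mul])

@[simp]
lemma IsCoefficient.bilin_apply (hA : IsCoefficient Ω A α β) (u v : V Ω) :
    hA.bilin u v = aform A u v := rfl

lemma IsCoefficient.aform_sub_left (hA : IsCoefficient Ω A α β) (u v q : V Ω) :
    aform A (u - v) q = aform A u q - aform A v q := by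
  simp only [← hA.bilin_apply, map_sub, LinearMap.sub_apply]

lemma IsCoefficient.le_aform (hA : IsCoefficient Ω A α β) (u : V Ω) :
    α * ‖gradL Ω u‖ ^ 2 ≤ aform A u u := by
  rw [← integral_norm_grad_sq, ← integral_const_mul]
  refine integral_mono_ae ((integrable_norm_grad_sq u).const_mul α) (hA.integrable u u) ?_
  filter_upwards [hA.symm, hA.spectrum_subset] with x h1 h2
  rw [← ofLp_dotProduct_self]
  exact (dotProduct_bounds h1 h2 _).1

lemma IsCoefficient.aform_le (hA : IsCoefficient Ω A α β) (u : V Ω) :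
    aform A u u ≤ β * ‖gradL Ω u‖ ^ 2 := by
  rw [← integral_norm_grad_sq, ← integral_const_mul]
  refine integral_mono_ae (hA.integrable u u) ((integrable_norm_grad_sq u).const_mul β) ?_
  filter_upwards [hA.symm, hA.spectrum_subset] with x h1 h2
  rw [← ofLp_dotProduct_self]
  exact (dotProduct_bounds h1 h2 _).2

lemma IsCoefficient.aform_nonneg (hA : IsCoefficient Ω A α β) (u : V Ω) : 0 ≤ aform A u u :=
  (mul_nonneg hA.pos.le (sq_nonneg _)).trans (hA.le_aform u)

lemma norm_gradL_le (u : V Ω) : ‖gradL Ω u‖ ≤ ‖u‖ :=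
  abs_le_of_sq_le_sq' (by nlinarith [norm_sq_eq u, sq_nonneg ‖fnL Ω u‖]) (norm_nonneg u) |>.2

/-- Cauchy-Schwarz for the nonnegative energy form; continuity is needed for the Lax-Milgram
projection. -/
lemma IsCoefficient.abs_aform_le (hA : IsCoefficient Ω A α β) (u v : V Ω) :
    |aform A u v| ≤ β * ‖u‖ * ‖v‖ := by
  have hβ : 0 ≤ β := hA.pos.le.trans hA.le
  have h := LinearMap.BilinForm.apply_mul_apply_le_of_forall_zero_le hA.bilin hA.aform_nonneg u v
  simp only [hA.bilin_apply, hA.aform_comm v u] at h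
  have hb : ∀ w : V Ω, aform A w w ≤ β * ‖w‖ ^ 2 := fun w => (hA.aform_le w).trans (by
    gcongr
    exact norm_gradL_le w)
  refine abs_le_of_sq_le_sq (b := β * ‖u‖ * ‖v‖) ?_ (by positivity)
  calc aform A u v ^ 2 = aform A u v * aform A u v := sq _
    _ ≤ aform A u u * aform A v v := h
    _ ≤ (β * ‖u‖ ^ 2) * (β * ‖v‖ ^ 2) :=
      mul_le_mul (hb u) (hb v) (hA.aform_nonneg v) (by positivity)
    _ = _ := by ring

lemma IsCoefficient.exists_coercive (hd : 1 ≤ d) (ho : IsOpen Ω) (hb : Bornology.IsBounded Ω)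
    (hA : IsCoefficient Ω A α β) : ∃ m : ℝ, 0 < m ∧ ∀ u : V Ω, m * ‖u‖ * ‖u‖ ≤ aform A u u := by
  obtain ⟨D, hD, hF⟩ := exists_norm_fnL_le hd ho hb
  refine ⟨α / (D ^ 2 + 1), div_pos hA.pos (by positivity), fun u => ?_⟩
  refine le_trans ?_ (hA.le_aform u)
  have h1 : ‖u‖ ^ 2 ≤ (D ^ 2 + 1) * ‖gradL Ω u‖ ^ 2 := by
    have : ‖fnL Ω u‖ ^ 2 ≤ (D * ‖gradL Ω u‖) ^ 2 := by
      gcongr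
      exact hF u
    nlinarith [norm_sq_eq u]
  rw [mul_assoc, ← sq, div_mul_eq_mul_div, div_le_iff₀ (by positivity), mul_assoc]
  refine mul_le_mul_of_nonneg_left ?_ hA.pos.le
  linarith

lemma IsCoefficient.eq_zero_of_aform_eq_zero (hd : 1 ≤ d) (ho : IsOpen Ω)
    (hb : Bornology.IsBounded Ω) (hA : IsCoefficient Ω A α β) {u : V Ω} (hu : aform A u u = 0) :
    u = 0 := by
  obtain ⟨m, hm, h⟩ := hA.exists_coercive hd ho hb
  have := h u
  rw [hu] at this
  by_contra hne
  have : 0 < ‖u‖ := norm_pos_iff.2 hne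
  have : 0 < m * ‖u‖ * ‖u‖ := by positivity
  linarith

/-- The energy projection onto a closed subspace. -/
lemma IsCoefficient.exists_projection (hd : 1 ≤ d) (ho : IsOpen Ω) (hb : Bornology.IsBounded Ω)
    (hA : IsCoefficient Ω A α β) (F : Submodule ℝ (V Ω)) (hF : IsClosed (F : Set (V Ω)))
    (w : V Ω) : ∃ p ∈ F, ∀ q ∈ F, aform A p q = aform A w q :=
  exists_projection_of_coercive
    (hA.bilin.mkContinuous₂ β (fun u v => hA.abs_aform_le u v))
    (hA.exists_coercive hd ho hb) F hF w

end Energy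

/-! ### The nodal functions in `H¹₀` and the approximation property -/

namespace Mesh

variable {d : ℕ} {Ω : Set (E d)} (𝒯 : Mesh Ω)

lemma exists_nodal (hΩ : IsBoundedLipschitzDomain Ω) :
    ∃ hv : 𝒯.interiorVertices → V Ω, ∀ z, hv z ∈ 𝒯.VH ∧
      (hv z).fn =ᵐ[volume.restrict Ω] 𝒯.hat z := by
  have : ∀ z : 𝒯.interiorVertices, ∃ u : V Ω, u ∈ 𝒯.VH ∧ u.fn =ᵐ[volume.restrict Ω] 𝒯.hat z := by
    intro z
    have hz := (𝒯.mem_interiorVertices.1 z.2).2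
    obtain ⟨L, hL⟩ := 𝒯.exists_lipschitzWith_hat hΩ hz
    obtain ⟨u, hu⟩ := exists_fn_eq_of_lipschitzWith hΩ.isOpen hΩ.isBounded hL (𝒯.hat_nonneg z)
      (fun x hx => 𝒯.hat_eq_zero_of_notMem_domain hΩ hz hx)
    refine ⟨u, fun T hT => ?_, hu⟩
    obtain ⟨f, hf⟩ := 𝒯.exists_affine_hat hT z
    exact ⟨f, hu.mono fun x hx hxT => by rw [hx, hf x hxT]⟩
  choose hv h using this
  exact ⟨hv, h⟩

lemma integral_hat_pos (hΩ : IsBoundedLipschitzDomain Ω) {z : E d} (hz : z ∈ 𝒯.interiorVertices) :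
    0 < ∫ y in Ω, 𝒯.hat z y := by
  have hzΩ := (𝒯.mem_interiorVertices.1 hz).2
  obtain ⟨L, hL⟩ := 𝒯.exists_lipschitzWith_hat hΩ hzΩ
  have hcs : HasCompactSupport (𝒯.hat z) := by
    refine (Metric.isCompact_of_isClosed_isBounded isClosed_closure
      hΩ.isBounded.closure).of_isClosed_subset (isClosed_tsupport _) (closure_mono fun x hx => ?_)
    by_contra h
    exact hx (𝒯.hat_eq_zero_of_notMem_domain hΩ hzΩ h)
  rw [setIntegral_eq_integral_of_forall_compl_eq_zero
    fun x hx => 𝒯.hat_eq_zero_of_notMem_domain hΩ hzΩ hx]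
  exact hL.continuous.integral_pos_of_hasCompactSupport_nonneg_nonzero hcs (𝒯.hat_nonneg z)
    (x := z) (by rw [𝒯.hat_vertex hz]; simp)

lemma coeFn_sum_nodal {hv : 𝒯.interiorVertices → V Ω}
    (hh : ∀ z, (hv z).fn =ᵐ[volume.restrict Ω] 𝒯.hat z) (m : 𝒯.interiorVertices → ℝ) :
    (∑ z, m z • fnL Ω (hv z) : Lp ℝ 2 (volume.restrict Ω)) =ᵐ[volume.restrict Ω]
      fun x => ∑ z, m z * 𝒯.hat z x := by
  have h1 : ∀ᵐ x ∂(volume.restrict Ω), ∀ z : 𝒯.interiorVertices,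
      (m z • fnL Ω (hv z) : Lp ℝ 2 (volume.restrict Ω)) x = m z * 𝒯.hat z x := by
    rw [ae_all_iff]
    intro z
    filter_upwards [Lp.coeFn_smul (m z) (fnL Ω (hv z)), hh z] with x hx hx'
    rw [hx, Pi.smul_apply, coeFn_fnL, hx', smul_eq_mul]
  filter_upwards [h1, Lp.coeFn_finsetSum Finset.univ fun z => m z • fnL Ω (hv z)] with x hx hx'
  rw [hx', Finset.sum_apply]
  exact Finset.sum_congr rfl fun z _ => hx z

/-- A continuous combination that vanishes almost everywhere on the open set `Ω` vanishes at each
interior vertex, where it returns a coefficient. -/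
lemma linearIndependent_nodal (hΩ : IsBoundedLipschitzDomain Ω) {hv : 𝒯.interiorVertices → V Ω}
    (hh : ∀ z, (hv z).fn =ᵐ[volume.restrict Ω] 𝒯.hat z) :
    LinearIndependent ℝ fun z => fnL Ω (hv z) := by
  rw [Fintype.linearIndependent_iff]
  intro m hm z
  have h1 := 𝒯.coeFn_sum_nodal hh m
  rw [hm] at h1
  have h2 := Measure.eqOn_open_of_ae_eq ((Lp.coeFn_zero ℝ 2 (volume.restrict Ω)).symm.trans h1)
    hΩ.isOpen continuousOn_const (Continuous.continuousOn (continuous_finsetSum _ fun y _ => by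
      obtain ⟨L, hL⟩ := 𝒯.exists_lipschitzWith_hat hΩ (𝒯.mem_interiorVertices.1 y.2).2
      exact continuous_const.mul hL.continuous))
  have h3 := h2 (𝒯.mem_interiorVertices.1 z.2).2
  simp only [𝒯.hat_vertex z.2] at h3
  simpa [Subtype.coe_inj] using h3.symm

/-- Functions that are `L²`-orthogonal to the nodal functions are small in a dual norm. -/
lemma exists_abs_inner_le (hd : 1 ≤ d) (hΩ : IsBoundedLipschitzDomain Ω) :
    ∃ C : ℝ, 0 < C ∧ ∀ (𝒯 : Mesh Ω) (hv : 𝒯.interiorVertices → V Ω),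
      (∀ z, (hv z).fn =ᵐ[volume.restrict Ω] 𝒯.hat z) → ∀ f : Lp ℝ 2 (volume.restrict Ω),
      (∀ z, inner ℝ f (fnL Ω (hv z)) = 0) → ∀ u : V Ω,
      |inner ℝ f (fnL Ω u)| ≤ C * 𝒯.size * ‖f‖ * ‖gradL Ω u‖ := by
  obtain ⟨D, hD, hF⟩ := exists_norm_fnL_le hd hΩ.isOpen hΩ.isBounded
  obtain ⟨h₀, hh₀, κ, hκ, hκ1, hball⟩ := hΩ.exists_exterior_ball
  set c₀ : ℝ := 2 + 8 * (3 / κ) ^ d with hc₀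
  have hc₀pos : 0 < c₀ := by positivity
  -- The term `√c₀` handles meshes with size at most `h₀`, where the exterior balls exist; `D / h₀`
  -- handles coarser ones by Friedrichs' inequality alone.
  refine ⟨√c₀ + D / h₀, by positivity, fun 𝒯 hv hh f hf u => ?_⟩
  have hsize := 𝒯.size_pos hd hΩ
  by_cases hle : 𝒯.size ≤ h₀
  · refine V.induction_of_isClosed
      (P := fun p => |inner ℝ f p.fst| ≤ (√c₀ + D / h₀) * 𝒯.size * ‖f‖ * ‖p.snd‖) ?_ ?_ u
    · exact isClosed_le (continuous_const.inner (WithLp.fstL 2 ℝ _ _).continuous).abs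
        (continuous_const.mul (WithLp.sndL 2 ℝ _ _).continuous.norm)
    rintro p ⟨φ, h1, h2, h3, h4, h5⟩
    -- Since `f` annihilates every nodal combination, the approximant can be chosen freely. Ball
    -- averages, unlike weighted averages over mesh patches, bring in the cells only through their
    -- diameters.
    set m : 𝒯.interiorVertices → ℝ := fun z => ballAverage φ (κ * 𝒯.size) z with hm
    set W : Lp ℝ 2 (volume.restrict Ω) := ∑ z, m z • fnL Ω (hv z) with hW
    have hfW : inner ℝ f W = 0 := by
      rw [hW, inner_sum]
      exact Finset.sum_eq_zero fun z _ => by rw [inner_smul_right, hf z, mul_zero]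
    have e1 : p.fst - W =ᵐ[volume.restrict Ω] fun x => φ x - ∑ z, m z * 𝒯.hat z x := by
      filter_upwards [Lp.coeFn_sub p.fst W, h4, 𝒯.coeFn_sum_nodal hh m] with x g1 g2 g3
      rw [g1, Pi.sub_apply, g2, g3]
    have e2 := lintegral_sub_sq_le_of_ballAverage hd (h1.of_le (by simp)) h2 hκ hκ1 hsize
      hΩ.isOpen.measurableSet (w := fun x => ∑ z, m z * 𝒯.hat z x) (fun x hx => by
        obtain ⟨T, hT, hxT⟩ := 𝒯.exists_cell_of_mem (subset_closure hx)
        have := 𝒯.sum_hat_mem_convexHull hT hxT (ballAverage φ (κ * 𝒯.size))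
          (s := ballAverage φ (κ * 𝒯.size) '' Metric.closedBall x (2 * 𝒯.size)) (fun z hz _ => by
            refine ⟨z, ?_, rfl⟩
            rw [Metric.mem_closedBall]
            linarith [𝒯.dist_le_size hT (subset_simplex T hz) hxT]) (fun z hz hzΩ => by
            -- A vertex outside `Ω` carries the nodal value zero, which is the average of `φ` over
            -- an exterior ball centred within `H` of that vertex, hence within `2 H` of `x`.
            have hzf : z ∈ frontier Ω := by
              rw [hΩ.isOpen.frontier_eq]
              exact ⟨𝒯.simplex_subset hT (subset_simplex T hz), hzΩ⟩
            obtain ⟨y, hy, hyΩ⟩ := hball z hzf 𝒯.size hsize hle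
            refine ⟨y, ?_, ballAverage_eq_zero fun x hx =>
              image_eq_zero_of_notMem_tsupport fun h => hyΩ x hx (h3 h)⟩
            rw [Metric.mem_closedBall]
            linarith [𝒯.dist_le_size hT (subset_simplex T hz) hxT, dist_triangle y z x])
        rwa [← Finset.sum_coe_sort] at this)
    rw [← enorm_sq_eq_lintegral e1, lintegral_enorm_fderiv_eq hΩ.isOpen h3,
      ← enorm_sq_eq_lintegral h5, ← hc₀] at e2
    have e3 : ‖p.fst - W‖ ≤ 𝒯.size * √c₀ * ‖p.snd‖ := by
      have e4 : 𝒯.size ^ 2 * c₀ = (𝒯.size * √c₀) ^ 2 := by rw [mul_pow, Real.sq_sqrt hc₀pos.le]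
      rw [e4, ENNReal.ofReal_pow (by positivity), ← mul_pow,
        ENNReal.pow_le_pow_left_iff (by norm_num), ← ofReal_norm, ← ofReal_norm,
        ← ENNReal.ofReal_mul (by positivity), ENNReal.ofReal_le_ofReal_iff (by positivity)] at e2
      exact e2
    calc |inner ℝ f p.fst| = |inner ℝ f (p.fst - W)| := by rw [inner_sub_right, hfW, sub_zero]
      _ ≤ ‖f‖ * ‖p.fst - W‖ := abs_real_inner_le_norm _ _
      _ ≤ ‖f‖ * (𝒯.size * √c₀ * ‖p.snd‖) := by gcongr
      _ = √c₀ * 𝒯.size * ‖f‖ * ‖p.snd‖ := by ring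
      _ ≤ _ := by
        gcongr
        have : 0 ≤ D / h₀ := by positivity
        linarith
  · push Not at hle
    calc |inner ℝ f (fnL Ω u)| ≤ ‖f‖ * ‖fnL Ω u‖ := abs_real_inner_le_norm _ _
      _ ≤ ‖f‖ * (D * ‖gradL Ω u‖) := by
        gcongr
        exact hF u
      _ = D * ‖f‖ * ‖gradL Ω u‖ := by ring
      _ ≤ _ := by
        gcongr
        calc D = D / h₀ * h₀ := by field_simp
          _ ≤ (√c₀ + D / h₀) * 𝒯.size := by
            gcongr
            linarith [Real.sqrt_nonneg c₀]

end Mesh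

/-! ### Perturbation of eigenspaces -/

section Abstract

lemma norm_sum_smul_sq {G ι : Type*} [NormedAddCommGroup G] [InnerProductSpace ℝ G] {v : ι → G}
    (hv : Orthonormal ℝ v) (c : ι → ℝ) (s : Finset ι) :
    ‖∑ i ∈ s, c i • v i‖ ^ 2 = ∑ i ∈ s, c i ^ 2 := by
  rw [← real_inner_self_eq_norm_sq, hv.inner_sum]
  exact Finset.sum_congr rfl fun i _ => by simp [sq]

/-- Polar decomposition: a linear map that almost preserves norms is close to an isometry. -/
lemma exists_linearIsometryEquiv_near {F : Type*} [NormedAddCommGroup F] [InnerProductSpace ℝ F]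
    [FiniteDimensional ℝ F] (M : F →ₗ[ℝ] F) {ε : ℝ} (hε : ε < 1)
    (h : ∀ x, |‖M x‖ - ‖x‖| ≤ ε * ‖x‖) :
    ∃ Q : F ≃ₗᵢ[ℝ] F, ∀ x, ‖M x - Q x‖ ≤ ε * ‖x‖ := by
  have hT : (LinearMap.adjoint M ∘ₗ M).IsSymmetric := fun x y => by
    simp [LinearMap.adjoint_inner_left, LinearMap.adjoint_inner_right]
  -- An eigenbasis of `M* M` consists of right singular vectors, with singular values `σ i = ‖M (e
  -- i)‖`; the hypothesis puts these within `ε` of 1.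
  let e := hT.eigenvectorBasis rfl
  set σ : Fin (Module.finrank ℝ F) → ℝ := fun i => ‖M (e i)‖ with hσ
  have hσ1 : ∀ i, |σ i - 1| ≤ ε := fun i => by
    have := h (e i)
    rwa [e.orthonormal.1 i, mul_one] at this
  have hσ0 : ∀ i, 0 < σ i := fun i => by linarith [(abs_le.1 (hσ1 i)).1]
  have horth : ∀ i j, i ≠ j → inner ℝ (M (e i)) (M (e j)) = 0 := by
    intro i j hij
    have h1 : inner ℝ (M (e i)) (M (e j)) =
        inner ℝ (e i) ((LinearMap.adjoint M ∘ₗ M) (e j)) := by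
      simp [LinearMap.adjoint_inner_right]
    rw [h1, hT.apply_eigenvectorBasis, inner_smul_right, e.orthonormal.2 hij, mul_zero]
  let Q₀ : F →ₗ[ℝ] F := e.toBasis.constr ℝ fun i => (σ i)⁻¹ • M (e i)
  have hQ₀ : ∀ i, Q₀ (e i) = (σ i)⁻¹ • M (e i) := fun i => by
    have := e.toBasis.constr_basis ℝ (fun i => (σ i)⁻¹ • M (e i)) i
    rwa [e.coe_toBasis] at this
  have horthQ : Orthonormal ℝ (Q₀ ∘ e.toBasis) := by
    refine ⟨fun i => ?_, fun i j hij => ?_⟩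
    · simp only [Function.comp, e.coe_toBasis, hQ₀, norm_smul, norm_inv]
      rw [Real.norm_of_nonneg (hσ0 i).le]
      exact inv_mul_cancel₀ (hσ0 i).ne'
    · simp only [Function.comp, e.coe_toBasis, hQ₀, inner_smul_left, inner_smul_right,
        horth i j hij, mul_zero]
  have hon : Orthonormal ℝ e.toBasis := by
    rw [e.coe_toBasis]
    exact e.orthonormal
  let Q : F →ₗᵢ[ℝ] F := Q₀.isometryOfOrthonormal hon horthQ
  have hQ : ∀ i, Q (e i) = (σ i)⁻¹ • M (e i) := hQ₀
  refine ⟨Q.toLinearIsometryEquiv rfl, fun x => ?_⟩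
  rw [LinearIsometry.coe_toLinearIsometryEquiv]
  -- This is `M - Q = Q (|M| - 1)`, with `|M|` diagonal in the basis `e`.
  have key : M x - Q x = Q (∑ i, ((σ i - 1) * e.repr x i) • e i) := by
    conv_lhs => rw [← e.sum_repr x]
    simp only [map_sum, map_smul, ← Finset.sum_sub_distrib]
    refine Finset.sum_congr rfl fun i _ => ?_
    rw [hQ, smul_smul, smul_smul, ← sub_smul]
    congr 1
    have := (hσ0 i).ne'
    field_simp
  rw [key, LinearIsometry.norm_map]
  have hε0 : 0 ≤ ε * ‖x‖ := (abs_nonneg _).trans (h x)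
  refine abs_le_of_sq_le_sq' ?_ hε0 |>.2
  rw [norm_sum_smul_sq e.orthonormal, mul_pow]
  have hx : ‖x‖ ^ 2 = ∑ i, e.repr x i ^ 2 := by
    rw [← e.repr.norm_map x, EuclideanSpace.norm_sq_eq]
    simp
  rw [hx, Finset.mul_sum]
  refine Finset.sum_le_sum fun i _ => ?_
  rw [mul_pow]
  refine mul_le_mul_of_nonneg_right ?_ (sq_nonneg _)
  rw [← sq_abs (σ i - 1)]
  exact pow_le_pow_left₀ (abs_nonneg _) (hσ1 i) 2

variable {X G ι : Type*} [AddCommGroup X] [Module ℝ X] [NormedAddCommGroup G]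
  [InnerProductSpace ℝ G]

/-- The coefficients, in the discrete eigenfunctions, of the energy projection of an eigenfunction
for the eigenvalue `lam`. -/
noncomputable def coarseCoeff (L : X →ₗ[ℝ] G) (uc : ι → X) (lamH : ι → ℝ) (lam : ℝ) (i : ι) :
    X →ₗ[ℝ] ℝ :=
  (lam / lamH i) • (innerₛₗ ℝ (L (uc i)) ∘ₗ L)

lemma coarseCoeff_apply (L : X →ₗ[ℝ] G) (uc : ι → X) (lamH : ι → ℝ) (lam : ℝ) (i : ι) (u : X) :
    coarseCoeff L uc lamH lam i u = lam / lamH i * inner ℝ (L (uc i)) (L u) := rfl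

variable [Fintype ι]

lemma sum_eq_sum_embedding_add {κ Y : Type*} [Fintype κ] [DecidableEq ι] [AddCommMonoid Y] (e : κ ↪ ι)
    (f : ι → Y) : ∑ i, f i = ∑ k, f (e k) + ∑ i ∈ (Finset.univ.map e)ᶜ, f i := by
  rw [← Finset.sum_add_sum_compl (Finset.univ.map e) f, Finset.sum_map]

/-- The complement of the energy projection. -/
noncomputable def fineRemainder (L : X →ₗ[ℝ] G) (uc : ι → X) (lamH : ι → ℝ) (lam : ℝ) (u : X) :
    X :=
  u - ∑ i, coarseCoeff L uc lamH lam i u • uc i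

/-- Orthonormality splits `(u_c^i, u)` into its remainder part and `c_i`. Rearranged, `(lamH i -
lam) c_i` is `lam` times the component of the remainder, so a small remainder forces small
coefficients away from `lam`. -/
lemma coarseCoeff_identity {L : X →ₗ[ℝ] G} {uc : ι → X} {lamH : ι → ℝ} {lam : ℝ}
    (huc : Orthonormal ℝ fun i => L (uc i)) (hpos : ∀ i, 0 < lamH i) (u : X) (i : ι) :
    lamH i * coarseCoeff L uc lamH lam i u = lam *
      (inner ℝ (L (uc i)) (L (fineRemainder L uc lamH lam u)) + coarseCoeff L uc lamH lam i u) := by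
  have h1 : inner ℝ (L (uc i)) (L (fineRemainder L uc lamH lam u)) =
      inner ℝ (L (uc i)) (L u) - coarseCoeff L uc lamH lam i u := by
    rw [fineRemainder, map_sub, inner_sub_right, map_sum]
    simp only [map_smul]
    rw [huc.inner_right_fintype]
  rw [h1, sub_add_cancel, coarseCoeff_apply]
  have := (hpos i).ne'
  field_simp

/-- The second bound re-inserts the identity to trade `lamH` for `lam`, so that no upper bound on
the discrete eigenvalues outside the cluster is required. -/
lemma sq_coarseCoeff_le {g c lam lamH ρ : ℝ} (hl : 0 < lam) (hρ : 0 ≤ ρ)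
    (hgap : lam ≤ ρ * |lam - lamH|) (hid : lamH * c = lam * (g + c)) :
    c ^ 2 ≤ ρ ^ 2 * g ^ 2 ∧ lamH * c ^ 2 ≤ lam * ((1 + ρ) ^ 2 * g ^ 2) := by
  have h0 : 0 < |lam - lamH| := by
    by_contra! h
    nlinarith [abs_nonneg (lam - lamH)]
  have h1 : |lam - lamH| * |c| = lam * |g| := by
    rw [← abs_mul, ← abs_of_pos hl, ← abs_mul, abs_of_pos hl, ← abs_neg]
    congr 1
    linarith
  have h2 : |c| ≤ ρ * |g| := by
    have : |lam - lamH| * |c| ≤ |lam - lamH| * (ρ * |g|) := by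
      rw [h1]
      nlinarith [mul_le_mul_of_nonneg_right hgap (abs_nonneg g)]
    exact le_of_mul_le_mul_left this h0
  have h3 : c ^ 2 ≤ ρ ^ 2 * g ^ 2 := by
    rw [← sq_abs c, ← sq_abs g, ← mul_pow]
    exact pow_le_pow_left₀ (abs_nonneg _) h2 2
  refine ⟨h3, ?_⟩
  have h4 : g * c ≤ ρ * g ^ 2 := by
    calc g * c ≤ |g| * |c| := by rw [← abs_mul]; exact le_abs_self _
      _ ≤ |g| * (ρ * |g|) := by gcongr
      _ = ρ * g ^ 2 := by rw [← sq_abs g]; ring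
  calc lamH * c ^ 2 = lam * (g * c + c ^ 2) := by
        have : lamH * c ^ 2 = (lamH * c) * c := by ring
        rw [this, hid]
        ring
    _ ≤ lam * ((1 + ρ) ^ 2 * g ^ 2) := by
        refine mul_le_mul_of_nonneg_left ?_ hl.le
        nlinarith [mul_nonneg hρ (sq_nonneg g), sq_nonneg g]

/-- Abstract eigenspace perturbation: if the energy projections of the eigenfunctions `uh` for the
eigenvalue `lam` are close to them and the discrete eigenvalues outside the cluster `e` are separated
from `lam`, then the eigenspace has an orthonormal basis close to the cluster. -/
theorem exists_orthonormal_near [DecidableEq ι] (a : X →ₗ[ℝ] X →ₗ[ℝ] ℝ) (hsymm : ∀ u v, a u v = a v u)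
    (L : X →ₗ[ℝ] G) {r : ℕ} {uh : Fin r → X} (huh : Orthonormal ℝ fun i => L (uh i))
    {uc : ι → X} (huc : Orthonormal ℝ fun i => L (uc i)) {lamH : ι → ℝ} (hpos : ∀ i, 0 < lamH i)
    (hac : ∀ i j, a (uc i) (uc j) = if i = j then lamH i else 0) {lam : ℝ} (hl : 0 < lam)
    (hah : ∀ k i, a (uh k) (uc i) = lam * inner ℝ (L (uc i)) (L (uh k)))
    (e : Fin r ↪ ι) {ρ : ℝ} (hρ : 0 ≤ ρ) (hgap : ∀ i, i ∉ range e → lam ≤ ρ * |lam - lamH i|)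
    {τ σ : ℝ} (hτ : ∀ u ∈ Submodule.span ℝ (range uh),
      ‖L (fineRemainder L uc lamH lam u)‖ ≤ τ * ‖L u‖)
    (hσ : ∀ u ∈ Submodule.span ℝ (range uh),
      a (fineRemainder L uc lamH lam u) (fineRemainder L uc lamH lam u) ≤ (σ * ‖L u‖) ^ 2)
    (hε : (1 + ρ) * τ ≤ 1 / 2) :
    ∃ ut : Fin r → X, (Orthonormal ℝ fun i => L (ut i)) ∧
      Submodule.span ℝ (range ut) = Submodule.span ℝ (range uh) ∧
      ∀ k, ‖L (ut k - uc (e k))‖ ≤ 2 * ((1 + ρ) * τ) ∧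
        a (ut k - uc (e k)) (ut k - uc (e k)) ≤ σ ^ 2 + 3 * lam * ((1 + ρ) * τ) ^ 2 := by
  rcases Nat.eq_zero_or_pos r with rfl | hr
  · exact ⟨uh, huh, rfl, fun k => k.elim0⟩
  have hτ0 : 0 ≤ τ := by
    have := hτ (uh ⟨0, hr⟩) (Submodule.subset_span ⟨_, rfl⟩)
    rw [huh.1, mul_one] at this
    exact (norm_nonneg _).trans this
  set c := coarseCoeff L uc lamH lam with hc
  set P := fineRemainder L uc lamH lam with hP
  set ε := (1 + ρ) * τ with hεdef
  have hε0 : 0 ≤ ε := by positivity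
  -- synthesis in the eigenspace
  let U : EuclideanSpace ℝ (Fin r) →ₗ[ℝ] X :=
    (Fintype.linearCombination ℝ uh) ∘ₗ (WithLp.linearEquiv 2 ℝ (Fin r → ℝ)).toLinearMap
  have hU : ∀ x, U x = ∑ k, x k • uh k := fun x => rfl
  have hUmem : ∀ x, U x ∈ Submodule.span ℝ (range uh) := fun x => by
    rw [hU]
    exact Submodule.sum_mem _ fun k _ => Submodule.smul_mem _ _ (Submodule.subset_span ⟨k, rfl⟩)
  have hnormU : ∀ x, ‖L (U x)‖ = ‖x‖ := fun x => by
    have : ‖L (U x)‖ ^ 2 = ‖x‖ ^ 2 := by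
      rw [hU, map_sum]
      simp only [map_smul]
      rw [norm_sum_smul_sq huh, EuclideanSpace.norm_sq_eq]
      simp
    exact (sq_eq_sq₀ (norm_nonneg _) (norm_nonneg _)).1 this
  let J : EuclideanSpace ℝ (Fin r) →ₗᵢ[ℝ] G := ⟨L ∘ₗ U, hnormU⟩
  -- the cluster part of the energy projection
  let M : EuclideanSpace ℝ (Fin r) →ₗ[ℝ] EuclideanSpace ℝ (Fin r) :=
    (WithLp.linearEquiv 2 ℝ (Fin r → ℝ)).symm.toLinearMap ∘ₗ LinearMap.pi fun k => c (e k) ∘ₗ U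
  have hM : ∀ x k, M x k = c (e k) (U x) := fun x k => rfl
  have hcluster : Orthonormal ℝ fun k => L (uc (e k)) := huc.comp e e.injective
  have hsumnorm : ∀ y : EuclideanSpace ℝ (Fin r), ‖∑ k, y k • L (uc (e k))‖ = ‖y‖ := fun y => by
    have : ‖∑ k, y k • L (uc (e k))‖ ^ 2 = ‖y‖ ^ 2 := by
      rw [norm_sum_smul_sq hcluster, EuclideanSpace.norm_sq_eq]
      simp
    exact (sq_eq_sq₀ (norm_nonneg _) (norm_nonneg _)).1 this
  set O : Finset ι := (Finset.univ.map e)ᶜ with hO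
  have hOr : ∀ i ∈ O, i ∉ range e := fun i hi ⟨k, hk⟩ => by
    rw [hO, Finset.mem_compl] at hi
    exact hi (Finset.mem_map.2 ⟨k, Finset.mem_univ _, hk⟩)
  have hbessel : ∀ x, ∑ i ∈ O, inner ℝ (L (uc i)) (L (P (U x))) ^ 2 ≤ (τ * ‖x‖) ^ 2 := fun x => by
    have h1 := huc.sum_inner_products_le (L (P (U x))) (s := O)
    simp only [Real.norm_eq_abs, sq_abs] at h1
    refine h1.trans (pow_le_pow_left₀ (norm_nonneg _) ?_ 2)
    rw [← hnormU x]
    exact hτ _ (hUmem x)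
  have hout : ∀ x, ∀ i ∈ O, c i (U x) ^ 2 ≤ ρ ^ 2 * inner ℝ (L (uc i)) (L (P (U x))) ^ 2 ∧
      lamH i * c i (U x) ^ 2 ≤ lam * ((1 + ρ) ^ 2 * inner ℝ (L (uc i)) (L (P (U x))) ^ 2) :=
    fun x i hi => sq_coarseCoeff_le hl hρ (hgap i (hOr i hi))
      (coarseCoeff_identity huc hpos (U x) i)
  have happrox : ∀ x, ‖L (U x) - ∑ k, M x k • L (uc (e k))‖ ≤ ε * ‖x‖ := fun x => by
    have h1 : L (U x) - ∑ k, M x k • L (uc (e k)) =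
        L (P (U x)) + ∑ i ∈ O, c i (U x) • L (uc i) := by
      rw [hP, fineRemainder, map_sub, map_sum, sum_eq_sum_embedding_add e, ← hO]
      simp only [map_smul, hM]
      abel
    have h2 : ‖∑ i ∈ O, c i (U x) • L (uc i)‖ ≤ ρ * (τ * ‖x‖) := by
      refine abs_le_of_sq_le_sq' ?_ (by positivity) |>.2
      rw [norm_sum_smul_sq huc, mul_pow]
      refine (Finset.sum_le_sum fun i hi => (hout x i hi).1).trans ?_
      rw [← Finset.mul_sum]
      exact mul_le_mul_of_nonneg_left (hbessel x) (sq_nonneg _)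
    have h3 := hτ _ (hUmem x)
    rw [hnormU] at h3
    rw [h1]
    calc _ ≤ ‖L (P (U x))‖ + ‖∑ i ∈ O, c i (U x) • L (uc i)‖ := norm_add_le _ _
      _ ≤ τ * ‖x‖ + ρ * (τ * ‖x‖) := add_le_add h3 h2
      _ = ε * ‖x‖ := by rw [hεdef]; ring
  -- The cluster functions are orthonormal, so `‖M x‖` is the norm of the cluster part of the
  -- projection, and `happrox` says that `M` almost preserves norms.
  obtain ⟨Q, hQ⟩ := exists_linearIsometryEquiv_near M (ε := ε) (by linarith) fun x => by
    have h1 := abs_norm_sub_norm_le (∑ k, M x k • L (uc (e k))) (L (U x))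
    rw [hsumnorm, hnormU, norm_sub_rev] at h1
    exact h1.trans (happrox x)
  -- The new basis is the isometric preimage of the standard one: it stays orthonormal, and `M (x
  -- k)` is within `ε` of the `k`-th unit vector.
  let x : Fin r → EuclideanSpace ℝ (Fin r) := fun k => Q.symm (EuclideanSpace.single k 1)
  have hxnorm : ∀ k, ‖x k‖ = 1 := fun k => by simp [x]
  have hQx : ∀ k, Q (x k) = EuclideanSpace.single k 1 := fun k => by simp [x]
  have hMQ : ∀ k, ‖M (x k) - EuclideanSpace.single k 1‖ ≤ ε := fun k => by
    have := hQ (x k)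
    rwa [hQx, hxnorm, mul_one] at this
  have hutorth : Orthonormal ℝ fun k => L (U (x k)) :=
    ((EuclideanSpace.basisFun (Fin r) ℝ).orthonormal.comp_linearIsometry
      Q.symm.toLinearIsometry).comp_linearIsometry J |> fun h => by
        convert h using 2 with k
        simp [x, J]
  -- Nothing is assumed about the discrete eigenvalues in the cluster. The diagonal coefficient is
  -- at least `1/2` and at most `lam / lamH (e k)`, which gives the bound.
  have hclusterle : ∀ k, lamH (e k) ≤ 2 * lam := fun k => by
    have h1 : |M (x k) k - 1| ≤ ε := by
      have := (PiLp.norm_apply_le (M (x k) - EuclideanSpace.single k 1) k).trans (hMQ k)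
      simpa using this
    have h2 : 1 / 2 ≤ M (x k) k := by linarith [(abs_le.1 h1).1]
    rw [hM, hc, coarseCoeff_apply] at h2
    have h3 : inner ℝ (L (uc (e k))) (L (U (x k))) ≤ 1 := by
      have := real_inner_le_norm (L (uc (e k))) (L (U (x k)))
      rwa [huc.1, hnormU, hxnorm, mul_one] at this
    have h4 : 1 / 2 ≤ lam / lamH (e k) :=
      h2.trans (mul_le_of_le_one_right (div_pos hl (hpos _)).le h3)
    rw [le_div_iff₀ (hpos _)] at h4
    linarith
  refine ⟨fun k => U (x k), hutorth, ?_, fun k => ⟨?_, ?_⟩⟩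
  · have h1 : (range fun k => U (x k)) = U '' range x := by rw [← range_comp]; rfl
    have h2 : range x = Q.symm.toLinearEquiv.toLinearMap '' range (EuclideanSpace.basisFun (Fin r) ℝ) := by
      rw [← range_comp]
      congr 1
      ext1 k
      simp [x]
    have h3 : Submodule.span ℝ (range (EuclideanSpace.basisFun (Fin r) ℝ)) = ⊤ := by
      rw [← (EuclideanSpace.basisFun (Fin r) ℝ).coe_toBasis]
      exact (EuclideanSpace.basisFun (Fin r) ℝ).toBasis.span_eq
    rw [h1, Submodule.span_image, h2, Submodule.span_image, h3, Submodule.map_top,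
      LinearEquiv.range, Submodule.map_top]
    have h4 : LinearMap.range U = LinearMap.range (Fintype.linearCombination ℝ uh) :=
      LinearMap.range_comp_of_range_eq_top _ (LinearEquiv.range _)
    rw [h4, Fintype.range_linearCombination]
  · have h1 : ∑ j, (EuclideanSpace.single k (1 : ℝ) : EuclideanSpace ℝ (Fin r)) j • L (uc (e j)) =
        L (uc (e k)) := by
      rw [Finset.sum_eq_single k] <;> simp +contextual
    have h2 : L (U (x k) - uc (e k)) = (L (U (x k)) - ∑ j, M (x k) j • L (uc (e j))) +
        ∑ j, (M (x k) - EuclideanSpace.single k 1 : EuclideanSpace ℝ (Fin r)) j • L (uc (e j)) := by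
      rw [map_sub, ← h1]
      simp only [PiLp.sub_apply, sub_smul, Finset.sum_sub_distrib]
      abel
    have h3 := happrox (x k)
    rw [hxnorm, mul_one] at h3
    rw [h2]
    refine (norm_add_le _ _).trans ?_
    rw [hsumnorm]
    linarith [hMQ k]
  · set y : ι → ℝ := fun i => c i (U (x k)) - if i = e k then 1 else 0 with hy
    have hD : U (x k) - uc (e k) = P (U (x k)) + ∑ i, y i • uc i := by
      simp only [hy, sub_smul, Finset.sum_sub_distrib, ite_smul, one_smul, zero_smul,
        Finset.sum_ite_eq', Finset.mem_univ, if_true]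
      rw [hP, fineRemainder]
      abel
    have haU : ∀ i, a (U (x k)) (uc i) = lam * inner ℝ (L (uc i)) (L (U (x k))) := fun i => by
      rw [hU]
      simp only [map_sum, map_smul, LinearMap.sum_apply, LinearMap.smul_apply, hah, inner_sum,
        inner_smul_right, smul_eq_mul, Finset.mul_sum]
      exact Finset.sum_congr rfl fun j _ => by ring
    -- The factor `lam / lamH i` in `coarseCoeff` makes the remainder energy-orthogonal to every
    -- discrete eigenfunction, so the energy error splits by Pythagoras.
    have hPo : ∀ i, a (P (U (x k))) (uc i) = 0 := fun i => by
      rw [hP, fineRemainder]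
      simp only [map_sub, map_sum, map_smul, LinearMap.sub_apply, LinearMap.sum_apply,
        LinearMap.smul_apply, hac, haU, smul_eq_mul, mul_ite, mul_zero, Finset.sum_ite_eq',
        Finset.mem_univ, if_true]
      rw [coarseCoeff_apply]
      have := (hpos i).ne'
      field_simp
      simp
    have hPS : a (P (U (x k))) (∑ i, y i • uc i) = 0 := by
      simp [map_sum, hPo]
    have hSS : a (∑ i, y i • uc i) (∑ i, y i • uc i) = ∑ i, lamH i * y i ^ 2 := by
      simp only [map_sum, map_smul, LinearMap.sum_apply, LinearMap.smul_apply, hac, smul_eq_mul,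
        mul_ite, mul_zero, Finset.sum_ite_eq', Finset.mem_univ, if_true]
      exact Finset.sum_congr rfl fun i _ => by ring
    have hexp : a (U (x k) - uc (e k)) (U (x k) - uc (e k)) =
        a (P (U (x k))) (P (U (x k))) + ∑ i, lamH i * y i ^ 2 := by
      rw [hD]
      simp only [map_add, LinearMap.add_apply]
      rw [hsymm (∑ i, y i • uc i) (P (U (x k))), hPS, hSS]
      ring
    have h1 := hσ _ (hUmem (x k))
    rw [hnormU, hxnorm, mul_one] at h1
    have h2 : ∑ j, lamH (e j) * y (e j) ^ 2 ≤ 2 * lam * ε ^ 2 := by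
      calc ∑ j, lamH (e j) * y (e j) ^ 2 ≤ ∑ j, 2 * lam * y (e j) ^ 2 :=
            Finset.sum_le_sum fun j _ =>
              mul_le_mul_of_nonneg_right (hclusterle j) (sq_nonneg _)
        _ = 2 * lam * ‖M (x k) - EuclideanSpace.single k 1‖ ^ 2 := by
            rw [← Finset.mul_sum, EuclideanSpace.norm_sq_eq]
            congr 1
            refine Finset.sum_congr rfl fun j _ => ?_
            rw [Real.norm_eq_abs, sq_abs]
            simp [hy, hM, PiLp.sub_apply, e.injective.eq_iff]
        _ ≤ 2 * lam * ε ^ 2 := by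
            gcongr
            exact hMQ k
    have h3 : ∑ i ∈ O, lamH i * y i ^ 2 ≤ lam * ε ^ 2 := by
      calc ∑ i ∈ O, lamH i * y i ^ 2 ≤ ∑ i ∈ O,
            lam * ((1 + ρ) ^ 2 * inner ℝ (L (uc i)) (L (P (U (x k)))) ^ 2) := by
            refine Finset.sum_le_sum fun i hi => ?_
            have : i ≠ e k := fun h => hOr i hi ⟨k, h.symm⟩
            simp only [hy, if_neg this, sub_zero]
            exact (hout (x k) i hi).2
        _ ≤ lam * ((1 + ρ) ^ 2 * τ ^ 2) := by
            rw [← Finset.mul_sum, ← Finset.mul_sum]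
            have := hbessel (x k)
            rw [hxnorm, mul_one] at this
            gcongr
        _ = lam * ε ^ 2 := by rw [hεdef, mul_pow]
    rw [hexp, sum_eq_sum_embedding_add e, ← hO]
    linarith

end Abstract

/-! ### The coarse space -/

namespace Mesh

variable {d : ℕ} {Ω : Set (E d)} (𝒯 : Mesh Ω) {A : E d → Matrix (Fin d) (Fin d) ℝ} {α β : ℝ}

/-- At an interior vertex only its own nodal function survives in the quasi-interpolant, and its
weight `(1, φ_z)` is positive; so the kernel is cut out by `L²`-orthogonality. -/
lemma mem_fineSpace_iff (hΩ : IsBoundedLipschitzDomain Ω) {hv : 𝒯.interiorVertices → V Ω}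
    (hh : ∀ z, (hv z).fn =ᵐ[volume.restrict Ω] 𝒯.hat z) (Vh : Submodule ℝ (V Ω)) (v : V Ω) :
    v ∈ 𝒯.fineSpace Vh ↔ v ∈ Vh ∧ ∀ z, inner ℝ (fnL Ω v) (fnL Ω (hv z)) = 0 := by
  have hint : ∀ z, inner ℝ (fnL Ω v) (fnL Ω (hv z)) = ∫ y in Ω, v.fn y * 𝒯.hat z y := by
    intro z
    rw [← l2_eq_inner, l2]
    refine integral_congr_ae ?_
    filter_upwards [hh z] with x hx
    rw [hx]
  refine and_congr_right fun _ => ⟨fun h z => ?_, fun h x _ => ?_⟩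
  · have h1 := h z (𝒯.mem_interiorVertices.1 z.2).2
    rw [clement, Finset.sum_eq_single (z : E d)] at h1
    · rw [𝒯.hat_vertex z.2, if_pos rfl, mul_one,
        div_eq_zero_iff, or_iff_left (𝒯.integral_hat_pos hΩ z.2).ne'] at h1
      rw [hint, h1]
    · intro y _ hy
      rw [𝒯.hat_vertex z.2, if_neg hy, mul_zero]
    · exact fun h => absurd z.2 h
  · refine Finset.sum_eq_zero fun z hz => ?_
    rw [← hint ⟨z, hz⟩, h, zero_div, zero_mul]

/-- The fine scale space as a closed subspace. -/
lemma exists_fineSubmodule (hΩ : IsBoundedLipschitzDomain Ω) {hv : 𝒯.interiorVertices → V Ω}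
    (hh : ∀ z, (hv z).fn =ᵐ[volume.restrict Ω] 𝒯.hat z) {Vh : Submodule ℝ (V Ω)}
    (hVh : IsClosed (Vh : Set (V Ω))) :
    ∃ F : Submodule ℝ (V Ω), (F : Set (V Ω)) = 𝒯.fineSpace Vh ∧ IsClosed (F : Set (V Ω)) := by
  let K : Submodule ℝ (V Ω) :=
    ⨅ z, LinearMap.ker ((innerSL ℝ (fnL Ω (hv z))).comp (fnL Ω)).toLinearMap
  have hK : ∀ v, v ∈ K ↔ ∀ z, inner ℝ (fnL Ω v) (fnL Ω (hv z)) = 0 := fun v => by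
    simp only [K, Submodule.mem_iInf, LinearMap.mem_ker]
    exact forall_congr' fun z => by rw [real_inner_comm]; rfl
  refine ⟨Vh ⊓ K, ?_, ?_⟩
  · ext v
    rw [𝒯.mem_fineSpace_iff hΩ hh, SetLike.mem_coe, Submodule.mem_inf, hK]
  · rw [Submodule.coe_inf, Submodule.coe_iInf]
    exact hVh.inter (isClosed_iInter fun z =>
      ((innerSL ℝ (fnL Ω (hv z))).comp (fnL Ω)).isClosed_ker)

/-- `L²`-projection onto the span of the nodal functions. -/
lemma exists_sub_sum_mem_fineSpace (hΩ : IsBoundedLipschitzDomain Ω)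
    {hv : 𝒯.interiorVertices → V Ω} (hh : ∀ z, (hv z).fn =ᵐ[volume.restrict Ω] 𝒯.hat z)
    {Vh : Submodule ℝ (V Ω)} (hmem : ∀ z, hv z ∈ Vh) {v : V Ω} (hvVh : v ∈ Vh) :
    ∃ m : 𝒯.interiorVertices → ℝ, v - ∑ z, m z • hv z ∈ 𝒯.fineSpace Vh := by
  let K : Submodule ℝ (Lp ℝ 2 (volume.restrict Ω)) :=
    Submodule.span ℝ (range fun z => fnL Ω (hv z))
  have : FiniteDimensional ℝ K := FiniteDimensional.span_of_finite ℝ (finite_range _)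
  obtain ⟨m, hm⟩ := (Submodule.mem_span_range_iff_exists_fun ℝ).1
    (K.starProjection_apply_mem (fnL Ω v))
  refine ⟨m, (𝒯.mem_fineSpace_iff hΩ hh Vh _).2 ⟨?_, fun z => ?_⟩⟩
  · exact Vh.sub_mem hvVh (Vh.sum_mem fun z _ => Vh.smul_mem _ (hmem z))
  · rw [map_sub, map_sum]
    simp only [map_smul]
    rw [hm, real_inner_comm]
    exact (Submodule.mem_orthogonal K _).1 (Submodule.sub_starProjection_mem_orthogonal (fnL Ω v)) _
      (Submodule.subset_span ⟨z, rfl⟩)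

/-- The structure of the coarse space: it is the energy-orthogonal complement of the fine scale
space, and its dimension is the number of interior vertices. -/
lemma coarseSpace_structure (hd : 1 ≤ d) (hΩ : IsBoundedLipschitzDomain Ω)
    (hA : IsCoefficient Ω A α β) {hv : 𝒯.interiorVertices → V Ω}
    (hh : ∀ z, (hv z).fn =ᵐ[volume.restrict Ω] 𝒯.hat z) (hvVH : ∀ z, hv z ∈ 𝒯.VH)
    {Vh : Submodule ℝ (V Ω)} (hVh : IsClosed (Vh : Set (V Ω))) (hVH : 𝒯.VH ≤ Vh) :
    (∀ v ∈ 𝒯.coarseSpace A Vh, v ∈ Vh ∧ ∀ q ∈ 𝒯.fineSpace Vh, aform A v q = 0) ∧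
    (∀ v ∈ Vh, ∃ w ∈ 𝒯.coarseSpace A Vh, v - w ∈ 𝒯.fineSpace Vh) ∧
    Module.rank ℝ (𝒯.coarseSpace A Vh) = 𝒯.numInterior := by
  obtain ⟨F, hFeq, hFc⟩ := 𝒯.exists_fineSubmodule hΩ hh hVh
  have hF : ∀ v, v ∈ 𝒯.fineSpace Vh ↔ v ∈ F := fun v => by rw [← hFeq]; rfl
  have hproj := fun w => hA.exists_projection hd hΩ.isOpen hΩ.isBounded F hFc w
  choose p hpF hp using hproj
  have hpc : ∀ w ∈ 𝒯.VH, w - p w ∈ 𝒯.coarseSpace A Vh := fun w hw =>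
    Submodule.subset_span ⟨w, hw, p w, ⟨(hF _).2 (hpF w), fun q hq => hp w q ((hF q).1 hq)⟩, rfl⟩
  have hortho : ∀ v ∈ 𝒯.coarseSpace A Vh, v ∈ Vh ∧ ∀ q ∈ 𝒯.fineSpace Vh, aform A v q = 0 := by
    intro v hvc
    induction hvc using Submodule.span_induction with
    | mem v h =>
      obtain ⟨w, hw, p, ⟨hpf, hpq⟩, rfl⟩ := h
      refine ⟨Vh.sub_mem (hVH hw) hpf.1, fun q hq => ?_⟩
      rw [hA.aform_sub_left, hpq q hq, sub_self]
    | zero => exact ⟨Vh.zero_mem, fun q _ => by rw [← hA.bilin_apply]; simp⟩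
    | add u v _ _ hu hv =>
      exact ⟨Vh.add_mem hu.1 hv.1, fun q hq => by
        rw [hA.aform_add_left, hu.2 q hq, hv.2 q hq, add_zero]⟩
    | smul c u _ hu =>
      exact ⟨Vh.smul_mem c hu.1, fun q hq => by rw [aform_smul_left, hu.2 q hq, mul_zero]⟩
  let g : 𝒯.interiorVertices → V Ω := fun z => hv z - p (hv z)
  have hgc : ∀ z, g z ∈ 𝒯.coarseSpace A Vh := fun z => hpc _ (hvVH z)
  have hdec : ∀ v ∈ Vh, ∃ m : 𝒯.interiorVertices → ℝ, v - ∑ z, m z • g z ∈ F := by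
    intro v hvVh
    obtain ⟨m, hm⟩ := 𝒯.exists_sub_sum_mem_fineSpace hΩ hh (fun z => hVH (hvVH z)) hvVh
    refine ⟨m, ?_⟩
    have e : v - ∑ z, m z • g z = (v - ∑ z, m z • hv z) + ∑ z, m z • p (hv z) := by
      simp only [g, smul_sub, Finset.sum_sub_distrib]
      abel
    rw [e]
    exact F.add_mem ((hF _).1 hm) (F.sum_mem fun z _ => F.smul_mem _ (hpF _))
  have hsum : ∀ m : 𝒯.interiorVertices → ℝ, ∑ z, m z • g z ∈ 𝒯.coarseSpace A Vh := fun m =>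
    Submodule.sum_mem _ fun z _ => Submodule.smul_mem _ _ (hgc z)
  refine ⟨hortho, fun v hvVh => ?_, ?_⟩
  · obtain ⟨m, hm⟩ := hdec v hvVh
    exact ⟨_, hsum m, (hF _).2 hm⟩
  · have hli : LinearIndependent ℝ g := by
      rw [Fintype.linearIndependent_iff]
      intro m hm
      have h1 : ∑ z, m z • hv z ∈ F := by
        have : ∑ z, m z • hv z = ∑ z, m z • p (hv z) := by
          rw [← sub_eq_zero, ← Finset.sum_sub_distrib, ← hm]
          exact Finset.sum_congr rfl fun z _ => by rw [← smul_sub]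
        rw [this]
        exact F.sum_mem fun z _ => F.smul_mem _ (hpF _)
      have h2 := ((𝒯.mem_fineSpace_iff hΩ hh Vh _).1 ((hF _).2 h1)).2
      -- A nodal combination that is also fine is `L²`-orthogonal to itself.
      have h3 : fnL Ω (∑ z, m z • hv z) = 0 := by
        rw [← inner_self_eq_zero (𝕜 := ℝ)]
        nth_rw 2 [map_sum]
        rw [inner_sum]
        exact Finset.sum_eq_zero fun z _ => by rw [map_smul, inner_smul_right, h2, mul_zero]
      rw [map_sum] at h3
      simp only [map_smul] at h3
      exact Fintype.linearIndependent_iff.1 (𝒯.linearIndependent_nodal hΩ hh) m h3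
    have hspan : Submodule.span ℝ (range g) = 𝒯.coarseSpace A Vh := by
      refine le_antisymm (Submodule.span_le.2 ?_) fun v hvc => ?_
      · rintro _ ⟨z, rfl⟩
        exact hgc z
      · obtain ⟨m, hm⟩ := hdec v (hortho v hvc).1
        -- The difference is both coarse and fine, hence energy-orthogonal to itself.
        have h1 := (hortho _ (Submodule.sub_mem _ hvc (hsum m))).2 _ ((hF _).2 hm)
        have h2 := hA.eq_zero_of_aform_eq_zero hd hΩ.isOpen hΩ.isBounded h1
        rw [sub_eq_zero.1 h2]
        exact Submodule.sum_mem _ fun z _ =>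
          Submodule.smul_mem _ _ (Submodule.subset_span ⟨z, rfl⟩)
    rw [← hspan, rank_span hli, Cardinal.mk_range_eq g hli.injective]
    simp [numInterior]

end Mesh

/-! ### Eigensystems -/

section Eigen

variable {d : ℕ} {Ω : Set (E d)} {A : E d → Matrix (Fin d) (Fin d) ℝ} {α β : ℝ}
  {W : Submodule ℝ (V Ω)} {lam : ℕ → ℝ} {u : ℕ → V Ω}

lemma IsEigenSystem.inner_eq (h : IsEigenSystem A W lam u) {k m : ℕ} (hk : IsIndex W k)
    (hm : IsIndex W m) : inner ℝ (fnL Ω (u k)) (fnL Ω (u m)) = if k = m then 1 else 0 := by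
  split_ifs with hkm
  · subst hkm
    rw [real_inner_self_eq_norm_sq, ← l2norm_eq_norm, h.norm_eq k hk, one_pow]
  · rw [← l2_eq_inner, h.orthogonal k m hk hm hkm]

lemma IsEigenSystem.pos (hd : 1 ≤ d) (hΩ : IsBoundedLipschitzDomain Ω)
    (hA : IsCoefficient Ω A α β) (h : IsEigenSystem A W lam u) {k : ℕ} (hk : IsIndex W k) :
    0 < lam k := by
  have h1 := (h.solves k hk).2 (u k) (h.solves k hk).1
  rw [l2_eq_inner, h.inner_eq hk hk, if_pos rfl, mul_one] at h1
  rw [← h1]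
  refine lt_of_le_of_ne (hA.aform_nonneg _) fun h0 => ?_
  have h2 := hA.eq_zero_of_aform_eq_zero hd hΩ.isOpen hΩ.isBounded h0.symm
  have h3 := h.norm_eq k hk
  rw [l2norm_eq_norm, h2, map_zero, norm_zero] at h3
  exact zero_ne_one h3

/-- With `μ > 0` a vanishing denominator would contribute `⊤`, so finiteness of the supremum
excludes it and the gap inequality can be stated in `ℝ`. -/
lemma le_gapRatio {N ℓ r : ℕ} {μ : ℝ} {lamH : ℕ → ℝ} (hμ : 0 < μ)
    (hρ : gapRatio N ℓ r μ lamH ≠ ⊤) {j : ℕ} (h1 : 1 ≤ j) (hN : j ≤ N)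
    (hj : ¬ (ℓ ≤ j ∧ j ≤ ℓ + r - 1)) :
    μ ≤ (gapRatio N ℓ r μ lamH).toReal * |μ - lamH j| := by
  have hle : ENNReal.ofReal μ / ENNReal.ofReal |μ - lamH j| ≤ gapRatio N ℓ r μ lamH :=
    le_iSup₂_of_le (f := fun j (_ : j ∈ {j : ℕ | 1 ≤ j ∧ j ≤ N ∧ ¬ (ℓ ≤ j ∧ j ≤ ℓ + r - 1)}) =>
      ENNReal.ofReal μ / ENNReal.ofReal |μ - lamH j|) j ⟨h1, hN, hj⟩ le_rfl
  have h0 : 0 < |μ - lamH j| := by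
    by_contra! h
    rw [ENNReal.ofReal_of_nonpos h, ENNReal.div_zero (ENNReal.ofReal_pos.2 hμ).ne'] at hle
    exact hρ (top_le_iff.1 hle)
  rw [← ENNReal.ofReal_div_of_pos h0, ENNReal.ofReal_le_iff_le_toReal hρ, div_le_iff₀ h0] at hle
  exact hle

lemma solves_of_mem_span (hA : IsCoefficient Ω A α β) {μ : ℝ} {s : Set (V Ω)}
    (hs : ∀ v ∈ s, SolvesEigenproblem A W μ v) {v : V Ω} (hv : v ∈ Submodule.span ℝ s) :
    v ∈ W ∧ ∀ w ∈ W, aform A v w = μ * inner ℝ (fnL Ω w) (fnL Ω v) := by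
  induction hv using Submodule.span_induction with
  | mem v h =>
    refine ⟨(hs v h).1, fun w hw => ?_⟩
    rw [(hs v h).2 w hw, l2_eq_inner, real_inner_comm]
  | zero => exact ⟨W.zero_mem, fun w _ => by rw [← hA.bilin_apply]; simp⟩
  | add v v' _ _ h h' =>
    refine ⟨W.add_mem h.1 h'.1, fun w hw => ?_⟩
    rw [hA.aform_add_left, h.2 w hw, h'.2 w hw, map_add, inner_add_right, mul_add]
  | smul c v _ h =>
    refine ⟨W.smul_mem c h.1, fun w hw => ?_⟩
    rw [aform_smul_left, h.2 w hw, map_smul, inner_smul_right]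
    ring

lemma isIndex_succ {N : ℕ} (hN : Module.rank ℝ W = N) (i : Fin N) : IsIndex W (i + 1) :=
  ⟨by omega, by rw [hN]; exact_mod_cast i.2⟩

lemma IsEigenSystem.orthonormal (h : IsEigenSystem A W lam u) {N : ℕ}
    (hN : Module.rank ℝ W = N) : Orthonormal ℝ fun i : Fin N => fnL Ω (u (i + 1)) := by
  rw [orthonormal_iff_ite]
  intro i j
  rw [h.inner_eq (isIndex_succ hN i) (isIndex_succ hN j)]
  simp [Fin.ext_iff]

lemma IsEigenSystem.aform_eq (h : IsEigenSystem A W lam u) {N : ℕ} (hN : Module.rank ℝ W = N)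
    (i j : Fin N) : aform A (u (i + 1)) (u (j + 1)) = if i = j then lam (i + 1) else 0 := by
  rw [(h.solves _ (isIndex_succ hN i)).2 _ (h.solves _ (isIndex_succ hN j)).1, l2_eq_inner,
    h.inner_eq (isIndex_succ hN i) (isIndex_succ hN j)]
  simp [Fin.ext_iff]

/-- In a finite-dimensional space the eigenfunctions form a basis. -/
lemma IsEigenSystem.exists_sum_eq (h : IsEigenSystem A W lam u) {N : ℕ}
    (hN : Module.rank ℝ W = N) {w : V Ω} (hw : w ∈ W) :
    ∃ b : Fin N → ℝ, ∑ i, b i • u (i + 1) = w := by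
  have hmem : ∀ i : Fin N, u (i + 1) ∈ W := fun i => (h.solves _ (isIndex_succ hN i)).1
  have hli : LinearIndependent ℝ fun i : Fin N => (⟨u (i + 1), hmem i⟩ : W) :=
    LinearIndependent.of_comp ((fnL Ω).toLinearMap ∘ₗ W.subtype)
      (h.orthonormal hN).linearIndependent
  have hfin : Module.finrank ℝ W = N := Module.finrank_eq_of_rank_eq hN
  have : FiniteDimensional ℝ W := Module.finite_of_rank_eq_nat hN
  have htop := hli.span_eq_top_of_card_eq_finrank' (by rw [hfin, Fintype.card_fin])
  have hmemspan : (⟨w, hw⟩ : W) ∈ Submodule.span ℝ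
      (range fun i : Fin N => (⟨u (i + 1), hmem i⟩ : W)) := by
    rw [htop]
    trivial
  obtain ⟨b, hb⟩ := (Submodule.mem_span_range_iff_exists_fun ℝ).1 hmemspan
  refine ⟨b, ?_⟩
  have := congrArg W.subtype hb
  simpa using this

/-- The expansion of the energy projection of an eigenfunction in discrete eigenfunctions. -/
lemma IsEigenSystem.fineRemainder_eq (hd : 1 ≤ d) (hΩ : IsBoundedLipschitzDomain Ω)
    (hA : IsCoefficient Ω A α β) (h : IsEigenSystem A W lam u) {N : ℕ} (hN : Module.rank ℝ W = N)
    {F : Set (V Ω)} (hF : ∀ v ∈ W, ∀ q ∈ F, aform A v q = 0) {μ : ℝ} {v w : V Ω}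
    (hv : ∀ w ∈ W, aform A v w = μ * inner ℝ (fnL Ω w) (fnL Ω v)) (hw : w ∈ W) (hf : v - w ∈ F) :
    fineRemainder (fnL Ω).toLinearMap (fun i : Fin N => u (i + 1)) (fun i => lam (i + 1)) μ v =
      v - w := by
  obtain ⟨b, rfl⟩ := h.exists_sum_eq hN hw
  rw [fineRemainder]
  congr 1
  refine Finset.sum_congr rfl fun i _ => ?_
  have hi := (h.solves _ (isIndex_succ hN i)).1
  have h1 := hF _ hi _ hf
  -- The fine part is invisible to the coarse eigenfunction, so `v` may be replaced by `w`;
  -- comparison with the eigenvalue equation of `v` identifies `b i` with `coarseCoeff`.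
  have h2 : aform A v (u (i + 1)) = b i * lam (i + 1) := by
    rw [hA.aform_comm, ← hA.bilin_apply, map_sub, LinearMap.sub_apply, map_sum,
      LinearMap.sum_apply, sub_eq_zero] at h1
    rw [← hA.bilin_apply, h1]
    simp only [map_smul, LinearMap.smul_apply, hA.bilin_apply, h.aform_eq hN, smul_eq_mul,
      mul_ite, mul_zero, Finset.sum_ite_eq', Finset.mem_univ, if_true]
  rw [hv _ hi] at h2
  have hpos := (h.pos hd hΩ hA (isIndex_succ hN i)).ne'
  congr 1
  rw [coarseCoeff_apply]
  simp only [ContinuousLinearMap.coe_coe]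
  rw [div_mul_eq_mul_div, h2]
  field_simp

/-- The fine scale part of an element of an eigenspace is of higher order. -/
lemma fine_part_bounds (hA : IsCoefficient Ω A α β) {μ δ : ℝ} (hμ : 0 < μ) (hδ : 0 ≤ δ)
    {u f : V Ω} (hff : aform A f f = μ * inner ℝ (fnL Ω f) (fnL Ω u))
    (huu : aform A u u = μ * ‖fnL Ω u‖ ^ 2)
    (hf : ∀ v : V Ω, |inner ℝ (fnL Ω f) (fnL Ω v)| ≤ δ * ‖fnL Ω f‖ * ‖gradL Ω v‖) :
    √(aform A f f) ≤ √μ ^ 3 * (δ / √α) ^ 2 * ‖fnL Ω u‖ ∧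
      ‖fnL Ω f‖ ≤ √μ ^ 3 * (δ / √α) ^ 3 * ‖fnL Ω u‖ := by
  have hα := hA.pos
  have hsα : 0 < √α := Real.sqrt_pos.2 hα
  have hgrad : ∀ v : V Ω, ‖gradL Ω v‖ ≤ √(aform A v v) / √α := fun v => by
    rw [le_div_iff₀ hsα, ← Real.sqrt_sq (norm_nonneg (gradL Ω v)), ← Real.sqrt_mul (sq_nonneg _),
      mul_comm]
    exact Real.sqrt_le_sqrt (hA.le_aform v)
  set s := √(aform A f f) with hs
  have hs0 : 0 ≤ s := Real.sqrt_nonneg _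
  have hs2 : s ^ 2 = aform A f f := Real.sq_sqrt (hA.aform_nonneg f)
  set η := δ / √α with hη
  have hη0 : 0 ≤ η := by positivity
  have hbound : ∀ v : V Ω, |inner ℝ (fnL Ω f) (fnL Ω v)| ≤ η * ‖fnL Ω f‖ * √(aform A v v) :=
    fun v => (hf v).trans (by
      calc δ * ‖fnL Ω f‖ * ‖gradL Ω v‖ ≤ δ * ‖fnL Ω f‖ * (√(aform A v v) / √α) := by
            gcongr
            exact hgrad v
        _ = _ := by rw [hη]; ring)
  have hfn : ‖fnL Ω f‖ ≤ η * s := by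
    have h1 := hbound f
    rw [real_inner_self_eq_norm_sq, abs_of_nonneg (sq_nonneg _)] at h1
    rcases (norm_nonneg (fnL Ω f)).eq_or_lt with h0 | h0
    · rw [← h0]
      positivity
    · refine le_of_mul_le_mul_left ?_ h0
      calc _ = ‖fnL Ω f‖ ^ 2 := by ring
        _ ≤ η * ‖fnL Ω f‖ * s := h1
        _ = _ := by ring
  have hu : √(aform A u u) = √μ * ‖fnL Ω u‖ := by
    rw [huu, Real.sqrt_mul hμ.le, Real.sqrt_sq (norm_nonneg _)]
  -- The dual bound is used at `u`, whose energy norm is `√μ ‖u‖`, and then `hfn` trades `‖f‖` for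
  -- another factor `η s`; one power of `s` cancels.
  have hse : s ≤ √μ ^ 3 * η ^ 2 * ‖fnL Ω u‖ := by
    have h1 : s ^ 2 ≤ μ * (η * (η * s) * (√μ * ‖fnL Ω u‖)) := by
      rw [hs2, hff]
      refine mul_le_mul_of_nonneg_left ?_ hμ.le
      refine (le_abs_self _).trans ((hbound u).trans ?_)
      rw [hu]
      gcongr
    rcases hs0.eq_or_lt with h0 | h0
    · rw [← h0]
      positivity
    · refine le_of_mul_le_mul_left ?_ h0
      calc s * s = s ^ 2 := by ring
        _ ≤ _ := h1
        _ = s * ((√μ) ^ 2 * √μ * η ^ 2 * ‖fnL Ω u‖) := by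
          rw [Real.sq_sqrt hμ.le]
          ring
        _ = _ := by ring
  refine ⟨hse, hfn.trans ?_⟩
  calc η * s ≤ η * (√μ ^ 3 * η ^ 2 * ‖fnL Ω u‖) := by gcongr
    _ = _ := by ring

/-- The same bounds in terms of the discrete eigenfunctions. -/
lemma IsEigenSystem.fineRemainder_bounds (hd : 1 ≤ d) (hΩ : IsBoundedLipschitzDomain Ω)
    (hA : IsCoefficient Ω A α β) (h : IsEigenSystem A W lam u) {N : ℕ} (hN : Module.rank ℝ W = N)
    {Vh : Submodule ℝ (V Ω)} {F : Set (V Ω)} (hW : ∀ v ∈ W, v ∈ Vh ∧ ∀ q ∈ F, aform A v q = 0)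
    (hF : F ⊆ Vh) (hdec : ∀ v ∈ Vh, ∃ w ∈ W, v - w ∈ F) {δ : ℝ} (hδ : 0 ≤ δ)
    (hsmall : ∀ f ∈ F, ∀ v : V Ω,
      |inner ℝ (fnL Ω f) (fnL Ω v)| ≤ δ * ‖fnL Ω f‖ * ‖gradL Ω v‖) {μ : ℝ} (hμ : 0 < μ) {v : V Ω}
    (hv : v ∈ Vh ∧ ∀ w ∈ Vh, aform A v w = μ * inner ℝ (fnL Ω w) (fnL Ω v)) (P : V Ω)
    (hP : P = fineRemainder (fnL Ω).toLinearMap (fun i : Fin N => u (i + 1))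
      (fun i => lam (i + 1)) μ v) :
    √(aform A P P) ≤ √μ ^ 3 * (δ / √α) ^ 2 * ‖fnL Ω v‖ ∧
      ‖fnL Ω P‖ ≤ √μ ^ 3 * (δ / √α) ^ 3 * ‖fnL Ω v‖ := by
  obtain ⟨w, hw, hf⟩ := hdec v hv.1
  rw [h.fineRemainder_eq hd hΩ hA hN (fun v hv => (hW v hv).2)
    (fun w hw => hv.2 w (hW w hw).1) hw hf] at hP
  subst hP
  refine fine_part_bounds hA hμ hδ ?_ ?_ (hsmall _ hf)
  · rw [← hv.2 _ (hF hf), hA.aform_sub_left, (hW w hw).2 _ hf, sub_zero]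
  · rw [hv.2 v hv.1, real_inner_self_eq_norm_sq]

/-! ### Scalar estimates: the smallness condition and the final powers of the mesh size -/

lemma rpow_three_halves {x : ℝ} (hx : 0 ≤ x) : x ^ (3 / 2 : ℝ) = √x ^ 3 := by
  rw [Real.sqrt_eq_rpow, ← Real.rpow_natCast, ← Real.rpow_mul hx]
  norm_num

lemma cube_rpow_neg_third {x : ℝ} (hx : 0 ≤ x) : (x ^ (-(1 / 3) : ℝ)) ^ 3 = x⁻¹ := by
  rw [← Real.rpow_natCast, ← Real.rpow_mul hx, ← Real.rpow_neg_one]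
  norm_num

/-- Cubing removes the exponents `-1/3`: the factor `(1 + R)` cancels and `(c C₁)³ = 1/8` remains,
times `ℓ⁻¹ ≤ 1`. -/
lemma smallness_cubed {s c C₁ R μ ℓ : ℝ} (hC₁ : 0 < C₁) (hc : c = 1 / (2 * C₁)) (hs : 0 < s)
    (hR : 0 ≤ R) (hℓ : 1 ≤ ℓ) (hα : 0 < α) (hμ : 0 < μ)
    (h : s ≤ c * ℓ ^ (-(1 / 3) : ℝ) * (1 + R) ^ (-(1 / 3) : ℝ) * √(α / μ)) :
    (1 + R) * (√μ ^ 3 * (C₁ * s / √α) ^ 3) ≤ 1 / 2 := by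
  have ht0 : 0 < √μ := Real.sqrt_pos.2 hμ
  have hb0 : 0 < √α := Real.sqrt_pos.2 hα
  have h1 : s * √μ / √α ≤ c * ℓ ^ (-(1 / 3) : ℝ) * (1 + R) ^ (-(1 / 3) : ℝ) := by
    rw [Real.sqrt_div hα.le] at h
    rw [div_le_iff₀ hb0, ← le_div_iff₀ ht0]
    calc s ≤ _ := h
      _ = _ := by ring
  have h2 : (s * √μ / √α) ^ 3 ≤ c ^ 3 * ℓ⁻¹ * (1 + R)⁻¹ := by
    rw [← cube_rpow_neg_third (by positivity : (0 : ℝ) ≤ ℓ),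
      ← cube_rpow_neg_third (by positivity : (0 : ℝ) ≤ 1 + R), ← mul_pow, ← mul_pow]
    exact pow_le_pow_left₀ (by positivity) h1 3
  calc (1 + R) * (√μ ^ 3 * (C₁ * s / √α) ^ 3) = (1 + R) * C₁ ^ 3 * (s * √μ / √α) ^ 3 := by
        ring
    _ ≤ (1 + R) * C₁ ^ 3 * (c ^ 3 * ℓ⁻¹ * (1 + R)⁻¹) := by gcongr
    _ = 1 / 8 * ℓ⁻¹ := by
        rw [hc]
        field_simp
        norm_num
    _ ≤ 1 / 8 * 1 := by
        gcongr
        exact inv_le_one_of_one_le₀ hℓ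
    _ ≤ 1 / 2 := by norm_num

lemma energy_bound {s C₁ R μ ℓ x : ℝ} (hC₁ : 0 < C₁) (hs : 0 < s) (hR : 0 ≤ R) (hℓ : 1 ≤ ℓ)
    (hα : 0 < α) (hμ : 0 < μ)
    (h : x ≤ (√μ ^ 3 * (C₁ * s / √α) ^ 2) ^ 2 +
      3 * μ * ((1 + R) * (√μ ^ 3 * (C₁ * s / √α) ^ 3)) ^ 2) :
    √x ≤ (C₁ ^ 2 + 2 * C₁ ^ 3) * (√ℓ * (μ ^ (3 / 2 : ℝ) / α) * s ^ 2
      + ℓ * (1 + R) * (μ ^ 2 / α ^ (3 / 2 : ℝ)) * s ^ 3) := by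
  rw [rpow_three_halves hμ.le, rpow_three_halves hα.le]
  obtain ⟨t, ht0, rfl⟩ : ∃ t, 0 < t ∧ μ = t ^ 2 :=
    ⟨√μ, Real.sqrt_pos.2 hμ, (Real.sq_sqrt hμ.le).symm⟩
  obtain ⟨b, hb0, rfl⟩ : ∃ b, 0 < b ∧ α = b ^ 2 :=
    ⟨√α, Real.sqrt_pos.2 hα, (Real.sq_sqrt hα.le).symm⟩
  rw [Real.sqrt_sq ht0.le, Real.sqrt_sq hb0.le] at h ⊢
  have hsq : 1 ≤ √ℓ := Real.one_le_sqrt.2 hℓ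
  set ε := (1 + R) * (t ^ 3 * (C₁ * s / b) ^ 3) with hεdef
  have hε0 : 0 ≤ ε := by positivity
  have h3 : √x ≤ t ^ 3 * (C₁ * s / b) ^ 2 + 2 * (t * ε) := by
    -- The inequality is `p² + 3 q² ≤ (p + 2 q)²` for nonnegative `p` and `q = t ε`.
    refine Real.sqrt_le_iff.2 ⟨by positivity, h.trans ?_⟩
    have : 0 ≤ t ^ 3 * (C₁ * s / b) ^ 2 * (t * ε) := by positivity
    nlinarith [sq_nonneg (t * ε)]
  refine h3.trans ?_
  have e1 : t ^ 3 * (C₁ * s / b) ^ 2 = C₁ ^ 2 * (1 * (t ^ 3 / b ^ 2) * s ^ 2) := by ring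
  have e2 : 2 * (t * ε) = 2 * C₁ ^ 3 * (1 * (1 + R) * ((t ^ 2) ^ 2 / b ^ 3) * s ^ 3) := by
    rw [hεdef]
    ring
  -- The estimate so far is free of `ℓ`; the explicit factors 1 are enlarged to `√ℓ` and `ℓ` to
  -- match the stated bound.
  rw [e1, e2, mul_add (C₁ ^ 2 + 2 * C₁ ^ 3)]
  gcongr
  · linarith [pow_pos hC₁ 3]
  · linarith [pow_pos hC₁ 2]

lemma l2_bound {s C₁ R μ ℓ x : ℝ} (hC₁ : 0 < C₁) (hs : 0 < s) (hR : 0 ≤ R) (hℓ : 1 ≤ ℓ)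
    (hα : 0 < α) (hμ : 0 < μ) (h : x ≤ 2 * ((1 + R) * (√μ ^ 3 * (C₁ * s / √α) ^ 3))) :
    x ≤ (C₁ ^ 2 + 2 * C₁ ^ 3) * (ℓ * (1 + R) * (μ / α) ^ (3 / 2 : ℝ) * s ^ 3) := by
  refine h.trans ?_
  rw [rpow_three_halves (div_pos hμ hα).le, Real.sqrt_div hμ.le]
  have e1 : 2 * ((1 + R) * (√μ ^ 3 * (C₁ * s / √α) ^ 3)) =
      2 * C₁ ^ 3 * (1 * (1 + R) * (√μ / √α) ^ 3 * s ^ 3) := by ring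
  rw [e1]
  gcongr
  linarith [pow_pos hC₁ 2]

end Eigen

end Upscaling

open Upscaling in
/-- The constants `c`, `C` depend only on the domain and on the shape regularity. The fine space
`Vh` is any closed subspace of `H¹₀(Ω)` containing `V_H`, e.g. a finite element space or `H¹₀(Ω)`
itself. If `ρ = ∞` then `(1 + ρ)^{-1/3} = 0` and the smallness condition on `H` cannot hold, which
is what the hypothesis `ρ ≠ ∞` records. -/
theorem theorem5p5 {d : ℕ} (hd : 1 ≤ d) (Ω : Set (E d)) (hΩ : IsBoundedLipschitzDomain Ω)
    (γ : ℝ) :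
    ∃ c : ℝ, 0 < c ∧ ∃ C : ℝ, 0 < C ∧
      ∀ (𝒯 : Mesh Ω), 𝒯.shapeRegularity ≤ γ →
      ∀ (A : E d → Matrix (Fin d) (Fin d) ℝ) (α β : ℝ), IsCoefficient Ω A α β →
      ∀ (Vh : Submodule ℝ (V Ω)), IsClosed (Vh : Set (V Ω)) → 𝒯.VH ≤ Vh →
      ∀ (lamh : ℕ → ℝ) (uh : ℕ → V Ω), IsEigenSystem A Vh lamh uh →
      ∀ (lamH : ℕ → ℝ) (uc : ℕ → V Ω), IsEigenSystem A (𝒯.coarseSpace A Vh) lamH uc →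
      ∀ (ℓ r : ℕ), 1 ≤ ℓ → 1 ≤ r → ℓ + r - 1 ≤ 𝒯.numInterior →
        (∀ k, IsIndex Vh k → (lamh k = lamh ℓ ↔ ℓ ≤ k ∧ k ≤ ℓ + r - 1)) →
      ∀ (ρ : ℝ≥0∞), ρ = gapRatio 𝒯.numInterior ℓ r (lamh ℓ) lamH → ρ ≠ ⊤ →
        𝒯.size ≤ c * (ℓ : ℝ) ^ (-(1 / 3) : ℝ) * (1 + ρ.toReal) ^ (-(1 / 3) : ℝ)
          * √(α / lamh ℓ) →
      ∃ ut : Fin r → V Ω,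
        (∀ i j, l2 (ut i) (ut j) = if i = j then 1 else 0) ∧
        Submodule.span ℝ (Set.range ut)
          = Submodule.span ℝ (Set.range fun j : Fin r => uh (ℓ + j)) ∧
        ∀ j : Fin r,
          energyNorm A (ut j - uc (ℓ + j)) ≤
            C * (√(ℓ : ℝ) * (lamh ℓ ^ (3 / 2 : ℝ) / α) * 𝒯.size ^ 2
              + ℓ * (1 + ρ.toReal) * (lamh ℓ ^ 2 / α ^ (3 / 2 : ℝ)) * 𝒯.size ^ 3) ∧
          l2norm (ut j - uc (ℓ + j)) ≤
            C * (ℓ * (1 + ρ.toReal) * (lamh ℓ / α) ^ (3 / 2 : ℝ) * 𝒯.size ^ 3) := by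
  obtain ⟨C₁, hC₁, happ⟩ := Mesh.exists_abs_inner_le hd hΩ
  -- The first constant makes `(1 + ρ) τ ≤ 1/2` in the perturbation theorem. The second adds the
  -- coefficient `C₁ ^ 2` of the `H²` term and `2 * C₁ ^ 3` of the `H³` terms.
  refine ⟨1 / (2 * C₁), by positivity, C₁ ^ 2 + 2 * C₁ ^ 3, by positivity, ?_⟩
  intro 𝒯 _ A α β hA Vh hVh hVH lamh uh hsysh lamH uc hsysc ℓ r hℓ hr hN hmult ρ hρ hρtop hsmall
  obtain ⟨hv, hhv⟩ := 𝒯.exists_nodal hΩ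
  have hh := fun z => (hhv z).2
  obtain ⟨hortho, hdecomp, hrank⟩ :=
    𝒯.coarseSpace_structure hd hΩ hA hh (fun z => (hhv z).1) hVh hVH
  set N := 𝒯.numInterior with hNdef
  set Vc := 𝒯.coarseSpace A Vh with hVc
  have hVcVh : Vc ≤ Vh := fun v hv => (hortho v hv).1
  have hidxc : ∀ k, 1 ≤ k → k ≤ N → IsIndex Vc k := fun k h1 h2 =>
    ⟨h1, by rw [hrank]; exact_mod_cast h2⟩
  have hidxh : ∀ k, 1 ≤ k → k ≤ N → IsIndex Vh k := fun k h1 h2 =>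
    ⟨h1, (hidxc k h1 h2).2.trans (Submodule.rank_mono hVcVh)⟩
  have hH := 𝒯.size_pos hd hΩ
  have hμ : 0 < lamh ℓ := hsysh.pos hd hΩ hA (hidxh ℓ hℓ (by omega))
  set μ := lamh ℓ with hμdef
  have hα := hA.pos
  have hindex : ∀ k : Fin r, 1 ≤ ℓ + (k : ℕ) ∧ ℓ + (k : ℕ) ≤ N := fun k => by omega
  have hlamh : ∀ k : Fin r, lamh (ℓ + k) = μ := fun k =>
    (hmult _ (hidxh _ (hindex k).1 (hindex k).2)).2 (by omega)
  have horthh : Orthonormal ℝ fun k : Fin r => fnL Ω (uh (ℓ + k)) := by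
    rw [orthonormal_iff_ite]
    intro i j
    rw [hsysh.inner_eq (hidxh _ (hindex i).1 (hindex i).2) (hidxh _ (hindex j).1 (hindex j).2)]
    simp [Fin.ext_iff]
  have hucmem : ∀ i : Fin N, uc (i + 1) ∈ Vc := fun i =>
    (hsysc.solves _ (isIndex_succ hrank i)).1
  have hsolve : ∀ u ∈ Submodule.span ℝ (range fun k : Fin r => uh (ℓ + k)), u ∈ Vh ∧
      ∀ v ∈ Vh, aform A u v = μ * inner ℝ (fnL Ω v) (fnL Ω u) := by
    intro u hu
    refine solves_of_mem_span hA ?_ hu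
    rintro _ ⟨k, rfl⟩
    have := hsysh.solves _ (hidxh _ (hindex k).1 (hindex k).2)
    rwa [hlamh] at this
  have hbounds := fun u hu => hsysc.fineRemainder_bounds hd hΩ hA hrank hortho
    (fun f hf => hf.1) hdecomp (δ := C₁ * 𝒯.size) (by positivity)
    (fun f hf => happ 𝒯 hv hh _ ((𝒯.mem_fineSpace_iff hΩ hh Vh f).1 hf).2) hμ (hsolve u hu) _ rfl
  -- the cluster
  let e : Fin r ↪ Fin N := ⟨fun k => ⟨ℓ - 1 + k, by omega⟩, fun k k' h => by
    simp only [Fin.mk.injEq] at h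
    exact Fin.ext (by omega)⟩
  have hval : ∀ k : Fin r, ((e k : Fin N) : ℕ) = ℓ - 1 + k := fun _ => rfl
  have he : ∀ k : Fin r, ((e k : Fin N) : ℕ) + 1 = ℓ + k := fun k => by
    rw [hval]
    omega
  set R := ρ.toReal with hR
  have hR0 : 0 ≤ R := ENNReal.toReal_nonneg
  have hgap : ∀ i, i ∉ range e → μ ≤ R * |μ - lamH (i + 1)| := by
    intro i hi
    rw [hR, hρ]
    refine le_gapRatio hμ (hρ ▸ hρtop) (by omega) (by omega) fun h => hi ?_
    exact ⟨⟨i + 1 - ℓ, by omega⟩, Fin.ext (by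
      rw [hval]
      simp only
      omega)⟩
  have hℓ1 : (1 : ℝ) ≤ ℓ := by exact_mod_cast hℓ
  obtain ⟨ut, hut1, hut2, hut3⟩ := exists_orthonormal_near hA.bilin hA.aform_comm
    (fnL Ω).toLinearMap (uh := fun k : Fin r => uh (ℓ + k)) horthh
    (uc := fun i : Fin N => uc (i + 1)) (hsysc.orthonormal hrank) (lamH := fun i => lamH (i + 1))
    (fun i => hsysc.pos hd hΩ hA (isIndex_succ hrank i)) (hsysc.aform_eq hrank) hμ
    (fun k i => (hsolve _ (Submodule.subset_span ⟨k, rfl⟩)).2 _ (hVcVh (hucmem i))) e hR0 hgap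
    (τ := √μ ^ 3 * (C₁ * 𝒯.size / √α) ^ 3) (σ := √μ ^ 3 * (C₁ * 𝒯.size / √α) ^ 2)
    (fun u hu => (hbounds u hu).2)
    (fun u hu => by
      rw [hA.bilin_apply, ← Real.sq_sqrt (hA.aform_nonneg _)]
      exact pow_le_pow_left₀ (Real.sqrt_nonneg _) (hbounds u hu).1 2)
    (smallness_cubed hC₁ rfl hH hR0 hℓ1 hα hμ hsmall)
  refine ⟨ut, fun i j => ?_, hut2, fun k => ?_⟩
  · rw [l2_eq_inner]
    exact orthonormal_iff_ite.1 hut1 i j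
  obtain ⟨h1, h2⟩ := hut3 k
  simp only [he] at h1 h2
  refine ⟨energy_bound hC₁ hH hR0 hℓ1 hα hμ h2, ?_⟩
  rw [l2norm_eq_norm]
  exact l2_bound hC₁ hH hR0 hℓ1 hα hμ h1
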